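/- Let $\mathbb{M}_2=\mathbb{F}_2[\tau]$ and let $$\mathcal{A}_{*,*}=\mathbb{M}_2[\tau_i,\xi_{i+1}\mid i\ge 0]/(\tau_i^2+\tau\xi_{i+1})$$ be the dual motivic Steenrod algebra over $\mathbb{C}$ at the prime $2$. It is bigraded by $|\tau|=(0,-1)$, $|\tau_i|=(2^{i+1}-1,2^i-1)$, $|\xi_i|=(2^{i+1}-2,2^i-1)$, and is a commutative Hopf algebra over $\mathbb{M}_2$ with coproduct (where $\xi_0=1$) $$\psi(\xi_n)=\sum_{i=0}^n \xi_{n-i}^{2^i}\otimes\xi_i,\qquad \psi(\tau_n)=\sum_{i=0}^n \xi_{n-i}^{2^i}\otimes\tau_i+\tau_n\otimes 1,$$ and counit vanishing on every $\tau_n$ $(n\ge 0)$ and $\xi_n$ $(n\ge 1)$. A quotient Hopf algebra of $\mathcal{A}_{*,*}$ is a quotient by a bihomogeneous Hopf ideal. For functions $h:\{1,2,\dots\}\to\{0,1,\dots,\infty\}$ and $k:\{0,1,\dots\}\to\{0,1,\dots,\infty\}$ let $B_{*,*}(h,k)$ be the quotient of $\mathcal{A}_{*,*}$ by the ideal $I(h,k)$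 generated by the elements $\xi_i^{2^{h(i)}}$ $(i\ge 1,\ h(i)<\infty)$ and $\tau_j^{2^{k(j)}}$ $(j\ge 0,\ k(j)<\infty)$. The pair $(h,k)$ is called a free profile function if for all $i\ge 0$ one has $h(i+1)\le k(i)-1$ when $k(i)\ne 0$, and $h(i+1)=0$ when $k(i)=0$ (with $\infty-1=\infty$). Theorem. The quotient Hopf algebras of $\mathcal{A}_{*,*}$ that are free as $\mathbb{M}_2$-modules are exactly the quotients $B_{*,*}(h,k)$ for free profile functions $(h,k)$ satisfying the following two conditions: (1) for all $i,j\ge 1$: $h(i)\le j+h(i+j)$ or $h(j)\le h(i+j)$; (2) for all $i\ge 1$, $j\ge 0$: $h(i)\le j+k(i+j)$ or $k(j)\le k(i+j)$. That is, for an ideal $I\subset\mathcal{A}_{*,*}$, the quotient $\mathcal{A}_{*,*}/I$ is a quotient Hopf algebra that is free over $\mathbb{M}_2$ if and only if $I=I(h,k)$ for some free profile function $(h,k)$ satisfying (1) and (2). -/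

import Mathlib

open scoped TensorProduct

noncomputable section

namespace MotivicSteenrod

/-- The coefficient ring `M₂ = 𝔽₂[τ]`, the polynomial ring in one variable `τ`. -/
abbrev M2 : Type := Polynomial (ZMod 2)

/-- The algebra generators: `Gen.tau i` stands for `τ_i` (`i ≥ 0`), and
`Gen.xi i` stands for `ξ_{i+1}` (`i ≥ 0`). -/
inductive Gen : Type
  | tau (i : ℕ)
  | xi (i : ℕ)

/-- The ideal generated by the elements `τ_i ^ 2 + τ ξ_{i+1}`. -/
def relIdeal : Ideal (MvPolynomial Gen M2) :=
  Ideal.span (Set.range fun i : ℕ =>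
    MvPolynomial.X (Gen.tau i) ^ 2 + MvPolynomial.C Polynomial.X * MvPolynomial.X (Gen.xi i))

/-- The dual motivic Steenrod algebra
`M₂[τ_i, ξ_{i+1} | i ≥ 0] / (τ_i ^ 2 + τ ξ_{i+1})`. -/
def DualSteenrod : Type := MvPolynomial Gen M2 ⧸ relIdeal

instance : CommRing DualSteenrod := inferInstanceAs (CommRing (MvPolynomial Gen M2 ⧸ relIdeal))

instance : Algebra M2 DualSteenrod :=
  inferInstanceAs (Algebra M2 (MvPolynomial Gen M2 ⧸ relIdeal))

instance : Algebra (ZMod 2) DualSteenrod :=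
  inferInstanceAs (Algebra (ZMod 2) (MvPolynomial Gen M2 ⧸ relIdeal))

instance : IsScalarTower (ZMod 2) M2 DualSteenrod :=
  inferInstanceAs (IsScalarTower (ZMod 2) M2 (MvPolynomial Gen M2 ⧸ relIdeal))

/-- The quotient map from the polynomial ring. -/
def mk : MvPolynomial Gen M2 →ₐ[M2] DualSteenrod := Ideal.Quotient.mkₐ M2 relIdeal

lemma mk_surjective : Function.Surjective mk := Ideal.Quotient.mkₐ_surjective M2 relIdeal

/-- The class of `τ_i`, `i ≥ 0`. -/
def tau (i : ℕ) : DualSteenrod := mk (MvPolynomial.X (Gen.tau i))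

/-- The class of `ξ_i`, `i ≥ 0`, with `ξ_0 = 1`. -/
def xi : ℕ → DualSteenrod
  | 0 => 1
  | i + 1 => mk (MvPolynomial.X (Gen.xi i))

@[simp] lemma xi_zero : xi 0 = 1 := rfl

lemma two_eq_zero (B : Type*) [CommRing B] [Algebra M2 B] : (2 : B) = 0 := by
  have h : algebraMap M2 B 2 = 0 := by rw [CharTwo.two_eq_zero (R := M2), map_zero]
  rwa [map_ofNat] at h

lemma tau_sq (i : ℕ) : tau i ^ 2 = (Polynomial.X : M2) • xi (i + 1) := by
  have h : mk (MvPolynomial.X (Gen.tau i) ^ 2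
      + MvPolynomial.C Polynomial.X * MvPolynomial.X (Gen.xi i)) = 0 :=
    Ideal.Quotient.eq_zero_iff_mem.2 (Ideal.subset_span ⟨i, rfl⟩)
  rw [← MvPolynomial.smul_eq_C_mul, map_add, map_pow, map_smul] at h
  have h2 := two_eq_zero DualSteenrod
  change tau i ^ 2 + (Polynomial.X : M2) • xi (i + 1) = 0 at h
  linear_combination h - ((Polynomial.X : M2) • xi (i + 1)) * h2

/-- The `M₂`-algebra map out of the dual Steenrod algebra with prescribed values `t i` on `τ_i`
and `x i` on `ξ_{i+1}`. -/
def liftHom {B : Type*} [CommRing B] [Algebra M2 B] (t x : ℕ → B)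
    (h : ∀ i, t i ^ 2 = (Polynomial.X : M2) • x i) : DualSteenrod →ₐ[M2] B :=
  Ideal.Quotient.liftₐ relIdeal
    (MvPolynomial.aeval (fun g : Gen => match g with
      | Gen.tau i => t i
      | Gen.xi i => x i)) (by
    have hle : relIdeal ≤ RingHom.ker (MvPolynomial.aeval (R := M2) (fun g : Gen => match g with
      | Gen.tau i => t i
      | Gen.xi i => x i)) := by
      refine Ideal.span_le.2 ?_
      rintro _ ⟨i, rfl⟩
      have h2 := two_eq_zero B
      simp only [SetLike.mem_coe, RingHom.mem_ker, ← MvPolynomial.smul_eq_C_mul, map_add, map_pow,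
        map_smul, MvPolynomial.aeval_X, h]
      linear_combination ((Polynomial.X : M2) • x i) * h2
    exact fun a ha => hle ha)

section liftHom
variable {B : Type*} [CommRing B] [Algebra M2 B] (t x : ℕ → B)
    (h : ∀ i, t i ^ 2 = (Polynomial.X : M2) • x i)

@[simp] lemma liftHom_tau (i : ℕ) : liftHom t x h (tau i) = t i :=
  MvPolynomial.aeval_X _ _

@[simp] lemma liftHom_xi_succ (i : ℕ) : liftHom t x h (xi (i + 1)) = x i :=
  MvPolynomial.aeval_X _ _

end liftHom

lemma algHom_ext {B : Type*} [Semiring B] [Algebra M2 B] {f g : DualSteenrod →ₐ[M2] B}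
    (ht : ∀ i, f (tau i) = g (tau i)) (hx : ∀ i, f (xi i) = g (xi i)) : f = g := by
  refine Ideal.Quotient.algHom_ext M2 (MvPolynomial.algHom_ext ?_)
  rintro (i | i)
  · exact ht i
  · exact hx (i + 1)

/-! ### Squaring is additive -/

lemma sum_pow_two_pow {B : Type*} [CommRing B] [Algebra M2 B] {ι : Type*} (s : Finset ι)
    (f : ι → B) (n : ℕ) : (∑ i ∈ s, f i) ^ 2 ^ n = ∑ i ∈ s, f i ^ 2 ^ n := by
  have h2 := two_eq_zero B
  have hadd : ∀ a b : B, (a + b) ^ 2 = a ^ 2 + b ^ 2 := fun a b => by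
    linear_combination (a * b) * h2
  have hsq : ∀ g : ι → B, (∑ i ∈ s, g i) ^ 2 = ∑ i ∈ s, g i ^ 2 := fun g => by
    classical
    induction s using Finset.induction_on with
    | empty => simp
    | insert a s ha ih => rw [Finset.sum_insert ha, Finset.sum_insert ha, hadd, ih]
  induction n with
  | zero => simp
  | succ n ih => simp only [pow_succ, pow_mul, ih, hsq]

lemma sum_sq {B : Type*} [CommRing B] [Algebra M2 B] {ι : Type*} (s : Finset ι)
    (f : ι → B) : (∑ i ∈ s, f i) ^ 2 = ∑ i ∈ s, f i ^ 2 := by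
  simpa using sum_pow_two_pow s f 1

lemma add_sq' {B : Type*} [CommRing B] [Algebra M2 B] (a b : B) :
    (a + b) ^ 2 = a ^ 2 + b ^ 2 := by
  linear_combination (a * b) * two_eq_zero B

/-! ### The Hopf algebra structure -/

/-- `∑_{a+b=n} ξ_a ^ (2^b) ⊗ ξ_b`. -/
def comulXi (n : ℕ) : DualSteenrod ⊗[M2] DualSteenrod :=
  ∑ p ∈ Finset.HasAntidiagonal.antidiagonal n, (xi p.1 ^ 2 ^ p.2) ⊗ₜ[M2] xi p.2

/-- `∑_{a+b=n} ξ_a ^ (2^b) ⊗ τ_b + τ_n ⊗ 1`. -/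
def comulTau (n : ℕ) : DualSteenrod ⊗[M2] DualSteenrod :=
  ∑ p ∈ Finset.HasAntidiagonal.antidiagonal n, (xi p.1 ^ 2 ^ p.2) ⊗ₜ[M2] tau p.2 + tau n ⊗ₜ[M2] 1

lemma comulTau_sq (n : ℕ) : comulTau n ^ 2 = (Polynomial.X : M2) • comulXi (n + 1) := by
  rw [comulTau, comulXi, add_sq', sum_sq, Finset.Nat.sum_antidiagonal_succ', smul_add,
    Finset.smul_sum, add_comm]
  congr 1
  · simp [Algebra.TensorProduct.tmul_pow, tau_sq, TensorProduct.smul_tmul']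
  · refine Finset.sum_congr rfl fun p _ => ?_
    rw [Algebra.TensorProduct.tmul_pow, tau_sq, TensorProduct.tmul_smul, ← pow_mul, ← pow_succ]

/-- The coproduct: `ξ_n ↦ ∑_{a+b=n} ξ_a ^ (2^b) ⊗ ξ_b` and
`τ_n ↦ ∑_{a+b=n} ξ_a ^ (2^b) ⊗ τ_b + τ_n ⊗ 1`. -/
def comulHom : DualSteenrod →ₐ[M2] DualSteenrod ⊗[M2] DualSteenrod :=
  liftHom comulTau (fun n => comulXi (n + 1)) comulTau_sq

/-- The counit: `τ_n ↦ 0` and `ξ_{n+1} ↦ 0`. -/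
def counitHom : DualSteenrod →ₐ[M2] M2 :=
  liftHom (fun _ => 0) (fun _ => 0) (by simp)

lemma comulHom_tau (n : ℕ) : comulHom (tau n) = comulTau n := liftHom_tau _ _ _ n

lemma comulHom_xi (n : ℕ) : comulHom (xi n) = comulXi n := by
  cases n with
  | zero => simp [comulXi, Algebra.TensorProduct.one_def]
  | succ n => exact liftHom_xi_succ _ _ _ n

lemma counitHom_tau (n : ℕ) : counitHom (tau n) = 0 := liftHom_tau _ _ _ n

lemma counitHom_xi (n : ℕ) : counitHom (xi n) = if n = 0 then 1 else 0 := by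
  cases n with
  | zero => simp
  | succ n => exact liftHom_xi_succ (B := M2) _ _ _ n

/-- Reindexing sums over triples `(a, b, c)` with `a + b + c = n`. -/
lemma sum_triple {M : Type*} [AddCommMonoid M] (n : ℕ) (f : ℕ → ℕ → ℕ → M) :
    ∑ p ∈ Finset.HasAntidiagonal.antidiagonal n, ∑ q ∈ Finset.HasAntidiagonal.antidiagonal p.1, f q.1 q.2 p.2 =
      ∑ p ∈ Finset.HasAntidiagonal.antidiagonal n, ∑ q ∈ Finset.HasAntidiagonal.antidiagonal p.2, f p.1 q.1 q.2 := by
  rw [Finset.sum_sigma', Finset.sum_sigma']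
  refine Finset.sum_bij' (fun s _ => ⟨(s.2.1, s.2.2 + s.1.2), (s.2.2, s.1.2)⟩)
    (fun s _ => ⟨(s.1.1 + s.2.1, s.2.2), (s.1.1, s.2.1)⟩) ?_ ?_ ?_ ?_ ?_ <;>
  · rintro ⟨⟨a, b⟩, ⟨c, d⟩⟩ h
    simp only [Finset.mem_sigma, Finset.HasAntidiagonal.mem_antidiagonal] at h
    obtain ⟨h1, h2⟩ := h
    subst h2
    subst h1
    simp [add_assoc]

lemma comulXi_pow (a b : ℕ) : comulXi a ^ 2 ^ b =
    ∑ q ∈ Finset.HasAntidiagonal.antidiagonal a,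
      (xi q.1 ^ 2 ^ (q.2 + b)) ⊗ₜ[M2] (xi q.2 ^ 2 ^ b) := by
  rw [comulXi, sum_pow_two_pow]
  refine Finset.sum_congr rfl fun q _ => ?_
  rw [Algebra.TensorProduct.tmul_pow, ← pow_mul, ← pow_add]

lemma coassoc_aux (z : ℕ → DualSteenrod) (n : ℕ) :
    ∑ p ∈ Finset.HasAntidiagonal.antidiagonal n, (Algebra.TensorProduct.assoc M2 M2 M2 DualSteenrod DualSteenrod DualSteenrod)
      ((comulXi p.1 ^ 2 ^ p.2) ⊗ₜ[M2] z p.2) =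
    ∑ p ∈ Finset.HasAntidiagonal.antidiagonal n, (xi p.1 ^ 2 ^ p.2) ⊗ₜ[M2]
      ∑ q ∈ Finset.HasAntidiagonal.antidiagonal p.2, (xi q.1 ^ 2 ^ q.2) ⊗ₜ[M2] z q.2 := by
  simp only [comulXi_pow, TensorProduct.sum_tmul, TensorProduct.tmul_sum, map_sum,
    Algebra.TensorProduct.assoc_tmul]
  rw [sum_triple n (fun a b c => (xi a ^ 2 ^ (b + c)) ⊗ₜ[M2] ((xi b ^ 2 ^ c) ⊗ₜ[M2] z c))]
  refine Finset.sum_congr rfl fun p _ => Finset.sum_congr rfl fun q hq => ?_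
  rw [Finset.HasAntidiagonal.mem_antidiagonal.1 hq]

instance : Bialgebra M2 DualSteenrod :=
  Bialgebra.ofAlgHom comulHom counitHom
    (by
      refine algHom_ext (fun n => ?_) (fun n => ?_)
      · have := coassoc_aux tau n
        simp [comulHom_tau, comulHom_xi, comulTau, TensorProduct.add_tmul,
          TensorProduct.sum_tmul, TensorProduct.tmul_add, Finset.sum_add_distrib,
          Algebra.TensorProduct.one_def] at this ⊢
        rw [this]
        abel
      · have := coassoc_aux xi n
        simpa [comulHom_xi, comulXi, map_sum] using this)
    (by
      refine algHom_ext (fun n => ?_) (fun n => ?_)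
      · cases n with
        | zero => simp [comulHom_tau, comulTau, counitHom_tau]
        | succ n =>
          simp [comulHom_tau, comulTau, counitHom_tau, counitHom_xi,
            Finset.Nat.sum_antidiagonal_succ]
      · cases n with
        | zero => simp [Algebra.TensorProduct.one_def]
        | succ n =>
          simp [comulHom_xi, comulXi, counitHom_xi, Finset.Nat.sum_antidiagonal_succ])
    (by
      refine algHom_ext (fun n => ?_) (fun n => ?_)
      · simp [comulHom_tau, comulTau, counitHom_tau]
      · cases n with
        | zero => simp [Algebra.TensorProduct.one_def]
        | succ n =>
          simp [comulHom_xi, comulXi, counitHom_xi, Finset.Nat.sum_antidiagonal_succ'])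

lemma comul_tau (n : ℕ) : CoalgebraStruct.comul (R := M2) (tau n) =
    ∑ p ∈ Finset.HasAntidiagonal.antidiagonal n, (xi p.1 ^ 2 ^ p.2) ⊗ₜ[M2] tau p.2
      + tau n ⊗ₜ[M2] 1 := comulHom_tau n

lemma comul_xi (n : ℕ) : CoalgebraStruct.comul (R := M2) (xi n) =
    ∑ p ∈ Finset.HasAntidiagonal.antidiagonal n, (xi p.1 ^ 2 ^ p.2) ⊗ₜ[M2] xi p.2 :=
  comulHom_xi n

lemma counit_tau (n : ℕ) : CoalgebraStruct.counit (R := M2) (tau n) = 0 := counitHom_tau n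

lemma counit_xi (n : ℕ) : CoalgebraStruct.counit (R := M2) (xi n) = if n = 0 then 1 else 0 :=
  counitHom_xi n

/-- The conjugates of the `ξ_n`, determined by `∑_{a+b=n} χ(ξ_a) ^ (2^b) ξ_b = 0` for `n > 0`. -/
def conjXi : ℕ → DualSteenrod
  | 0 => 1
  | n + 1 => ∑ a : Fin (n + 1), conjXi a ^ 2 ^ (n - a + 1) * xi (n - a + 1)

lemma conjXi_zero : conjXi 0 = 1 := by rw [conjXi]

lemma conjXi_succ (n : ℕ) : conjXi (n + 1) =
    ∑ p ∈ Finset.HasAntidiagonal.antidiagonal n, conjXi p.1 ^ 2 ^ (p.2 + 1) * xi (p.2 + 1) := by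
  rw [conjXi, Finset.Nat.sum_antidiagonal_eq_sum_range_succ_mk,
    Finset.sum_range (fun a => conjXi a ^ 2 ^ (n - a + 1) * xi (n - a + 1))]

/-- The antipode, as an algebra map. -/
def conjHom : DualSteenrod →ₐ[M2] DualSteenrod :=
  liftHom (fun n => ∑ p ∈ Finset.HasAntidiagonal.antidiagonal n, conjXi p.1 ^ 2 ^ p.2 * tau p.2)
    (fun n => conjXi (n + 1)) (fun n => by
      rw [sum_sq, conjXi_succ, Finset.smul_sum]
      refine Finset.sum_congr rfl fun p _ => ?_
      rw [mul_pow, tau_sq, ← pow_mul, ← pow_succ, mul_smul_comm])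

lemma conjHom_tau (n : ℕ) : conjHom (tau n) =
    ∑ p ∈ Finset.HasAntidiagonal.antidiagonal n, conjXi p.1 ^ 2 ^ p.2 * tau p.2 :=
  liftHom_tau _ _ _ n

lemma conjHom_xi (n : ℕ) : conjHom (xi n) = conjXi n := by
  cases n with
  | zero => simp [conjXi_zero]
  | succ n => exact liftHom_xi_succ _ _ _ n

lemma conj_mul_id : WithConv.toConv conjHom * WithConv.toConv (AlgHom.id M2 DualSteenrod) = 1 := by
  have h2 := two_eq_zero DualSteenrod
  refine WithConv.ofConv_injective (algHom_ext (fun n => ?_) (fun n => ?_))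
  · change (WithConv.toConv conjHom * WithConv.toConv (AlgHom.id M2 DualSteenrod)) (tau n) =
      (1 : WithConv (DualSteenrod →ₐ[M2] DualSteenrod)) (tau n)
    rw [AlgHom.convMul_apply, AlgHom.convOne_apply, comul_tau, counit_tau]
    simp [conjHom_tau, conjHom_xi]
    linear_combination (∑ p ∈ Finset.HasAntidiagonal.antidiagonal n,
      conjXi p.1 ^ 2 ^ p.2 * tau p.2) * h2
  · change (WithConv.toConv conjHom * WithConv.toConv (AlgHom.id M2 DualSteenrod)) (xi n) =
      (1 : WithConv (DualSteenrod →ₐ[M2] DualSteenrod)) (xi n)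
    rw [AlgHom.convMul_apply, AlgHom.convOne_apply, comul_xi, counit_xi]
    cases n with
    | zero => simp
    | succ n =>
      simp [conjHom_xi, Finset.Nat.sum_antidiagonal_succ', ← conjXi_succ]
      linear_combination conjXi (n + 1) * h2

lemma id_mul_conj : WithConv.toConv (AlgHom.id M2 DualSteenrod) * WithConv.toConv conjHom = 1 := by
  have h : WithConv.toConv (conjHom.comp conjHom) * WithConv.toConv conjHom = 1 := by
    have := AlgHom.comp_convMul_distrib conjHom (WithConv.toConv conjHom)
      (WithConv.toConv (AlgHom.id M2 DualSteenrod))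
    rw [conj_mul_id] at this
    refine WithConv.ofConv_injective ?_
    refine Eq.trans (Eq.trans ?_ this.symm) ?_
    · simp
    · ext x
      simp [AlgHom.convOne_def]
  rwa [left_inv_eq_right_inv h conj_mul_id] at h

instance : HopfAlgebra M2 DualSteenrod :=
  HopfAlgebra.ofConvInverse conjHom.toLinearMap
    (congrArg (fun f => WithConv.toConv f.ofConv.toLinearMap) conj_mul_id)
    (congrArg (fun f => WithConv.toConv f.ofConv.toLinearMap) id_mul_conj)

/-! ### The bigrading -/

/-- Bidegrees of the generators: `|τ_i| = (2^(i+1) - 1, 2^i - 1)` and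
`|ξ_{i+1}| = (2^(i+2) - 2, 2^(i+1) - 1)`. -/
def Gen.bidegree : Gen → ℤ × ℤ
  | Gen.tau i => (2 ^ (i + 1) - 1, 2 ^ i - 1)
  | Gen.xi i => (2 ^ (i + 2) - 2, 2 ^ (i + 1) - 1)

/-- The element `τ ^ n · ∏ g ^ (s g)`, the product running over the generators `g`. -/
def mono (n : ℕ) (s : Gen →₀ ℕ) : DualSteenrod :=
  (Polynomial.X ^ n : M2) • mk (MvPolynomial.monomial s 1)

/-- The bidegree of `mono n s`, where `τ` has (homological) bidegree `(0, -1)`. -/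
def monoDegree (n : ℕ) (s : Gen →₀ ℕ) : ℤ × ℤ :=
  n • ((0, -1) : ℤ × ℤ) + s.sum fun g m => m • g.bidegree

/-- The homogeneous elements of bidegree `d`. -/
def bigrading (d : ℤ × ℤ) : Submodule (ZMod 2) DualSteenrod :=
  Submodule.span (ZMod 2) {y | ∃ n s, monoDegree n s = d ∧ mono n s = y}

lemma mono_mem (n : ℕ) (s : Gen →₀ ℕ) : mono n s ∈ bigrading (monoDegree n s) :=
  Submodule.subset_span ⟨n, s, rfl, rfl⟩

lemma mono_zero : mono 0 0 = 1 := by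
  simp [mono]

lemma mono_mul (n m : ℕ) (s t : Gen →₀ ℕ) : mono n s * mono m t = mono (n + m) (s + t) := by
  simp only [mono]
  rw [smul_mul_smul_comm, ← pow_add, ← map_mul, MvPolynomial.monomial_mul, one_mul]

lemma monoDegree_add (n m : ℕ) (s t : Gen →₀ ℕ) :
    monoDegree (n + m) (s + t) = monoDegree n s + monoDegree m t := by
  simp only [monoDegree]
  rw [Finsupp.sum_add_index' (by simp) (fun _ _ _ => add_smul _ _ _), add_smul]
  abel

instance : SetLike.GradedMonoid bigrading where
  one_mem := by
    have := mono_mem 0 0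
    rwa [mono_zero, show monoDegree 0 0 = 0 by simp [monoDegree]] at this
  mul_mem := by
    intro i j a b ha hb
    have h := Submodule.mul_mem_mul ha hb
    rw [bigrading, bigrading, Submodule.span_mul_span] at h
    refine Submodule.span_mono ?_ h
    rintro _ ⟨_, ⟨n, s, rfl, rfl⟩, _, ⟨m, t, rfl, rfl⟩, rfl⟩
    exact ⟨n + m, s + t, monoDegree_add n m s t, (mono_mul n m s t).symm⟩

lemma mono_single (g : Gen) : mono 0 (Finsupp.single g 1) = mk (MvPolynomial.X g) := by
  simp [mono, MvPolynomial.X]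

lemma mono_one : mono 1 0 = algebraMap M2 DualSteenrod Polynomial.X := by
  simp [mono, Algebra.smul_def]

lemma tauScalar_mem : algebraMap M2 DualSteenrod Polynomial.X ∈ bigrading (0, -1) := by
  have := mono_mem 1 0
  rwa [mono_one, show monoDegree 1 0 = (0, -1) by simp [monoDegree]] at this

lemma gen_mem (g : Gen) : mk (MvPolynomial.X g) ∈ bigrading g.bidegree := by
  have := mono_mem 0 (Finsupp.single g 1)
  rwa [mono_single, show monoDegree 0 (Finsupp.single g 1) = g.bidegree by simp [monoDegree]]
    at this

/-- The map sending a homogeneous element to its copy in the direct sum, on scalars. -/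
def decomposeScalar : M2 →+* DirectSum (ℤ × ℤ) (fun d => bigrading d) :=
  (Polynomial.aeval (R := ZMod 2)
    (DirectSum.of (fun d => bigrading d) (0, -1) ⟨_, tauScalar_mem⟩)).toRingHom

/-- The decomposition of polynomials into homogeneous components. -/
def decomposePoly : MvPolynomial Gen M2 →+* DirectSum (ℤ × ℤ) (fun d => bigrading d) :=
  MvPolynomial.eval₂Hom decomposeScalar
    (fun g => DirectSum.of (fun d => bigrading d) g.bidegree ⟨_, gen_mem g⟩)

lemma of_congr {d e : ℤ × ℤ} (h : d = e) {x y : DualSteenrod} (hx : x ∈ bigrading d)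
    (hy : y ∈ bigrading e) (hxy : x = y) :
    DirectSum.of (fun d => bigrading d) d ⟨x, hx⟩ = DirectSum.of (fun d => bigrading d) e ⟨y, hy⟩ := by
  subst h
  subst hxy
  rfl

lemma decomposePoly_rel (a : MvPolynomial Gen M2) (ha : a ∈ relIdeal) : decomposePoly a = 0 := by
  have hle : relIdeal ≤ RingHom.ker decomposePoly := by
    refine Ideal.span_le.2 ?_
    rintro _ ⟨i, rfl⟩
    simp only [SetLike.mem_coe, RingHom.mem_ker, map_add, map_pow, map_mul]
    have e1 : decomposePoly (MvPolynomial.X (Gen.tau i)) ^ 2 =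
        decomposePoly (MvPolynomial.C Polynomial.X) * decomposePoly (MvPolynomial.X (Gen.xi i)) := by
      simp only [decomposePoly, decomposeScalar, MvPolynomial.coe_eval₂Hom, MvPolynomial.eval₂_X,
        MvPolynomial.eval₂_C, AlgHom.toRingHom_eq_coe, RingHom.coe_coe, Polynomial.aeval_X, sq,
        DirectSum.of_mul_of]
      refine of_congr ?_ _ _ ?_
      · simp only [Gen.bidegree, Prod.mk_add_mk, Prod.mk.injEq]
        constructor <;> ring
      · have := tau_sq i
        rw [sq, Algebra.smul_def] at this
        exact this
    rw [e1, ← two_mul]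
    have h2 : (2 : DirectSum (ℤ × ℤ) (fun d => bigrading d)) = 0 := by
      have h := congrArg decomposeScalar (CharTwo.two_eq_zero (R := M2))
      rwa [map_ofNat, map_zero] at h
    rw [h2, zero_mul]
  exact hle ha

/-- The decomposition into homogeneous components. -/
def decomposeHom : DualSteenrod →+* DirectSum (ℤ × ℤ) (fun d => bigrading d) :=
  Ideal.Quotient.lift relIdeal decomposePoly decomposePoly_rel

lemma decomposeHom_gen (g : Gen) : decomposeHom (mk (MvPolynomial.X g)) =
    DirectSum.of (fun d => bigrading d) g.bidegree ⟨_, gen_mem g⟩ := by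
  change decomposePoly (MvPolynomial.X g) = _
  simp [decomposePoly]

lemma decomposeHom_tauScalar : decomposeHom (algebraMap M2 DualSteenrod Polynomial.X) =
    DirectSum.of (fun d => bigrading d) (0, -1) ⟨_, tauScalar_mem⟩ := by
  change decomposePoly (MvPolynomial.C Polynomial.X) = _
  simp [decomposePoly, decomposeScalar]

lemma coe_decomposeHom (x : DualSteenrod) :
    DirectSum.coeAddMonoidHom bigrading (decomposeHom x) = x := by
  have h : ((DirectSum.coeRingHom bigrading).comp decomposeHom).comp mk.toRingHom =
      mk.toRingHom := by
    refine MvPolynomial.ringHom_ext' ?_ ?_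
    · refine Polynomial.ringHom_ext' (Subsingleton.elim _ _) ?_
      have := decomposeHom_tauScalar
      change DirectSum.coeRingHom bigrading (decomposeHom (algebraMap M2 DualSteenrod _)) = _
      rw [this]
      exact DirectSum.coeRingHom_of bigrading _ _
    · intro g
      change DirectSum.coeRingHom bigrading (decomposeHom (mk (MvPolynomial.X g))) = _
      rw [decomposeHom_gen]
      exact DirectSum.coeRingHom_of bigrading _ _
  obtain ⟨y, rfl⟩ := mk_surjective x
  exact congrArg (fun f : MvPolynomial Gen M2 →+* DualSteenrod => f y) h

/-- The element `x` lies in bidegree `d` and `decomposeHom` sends it to its copy there. -/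
def IsSplitAt (d : ℤ × ℤ) (x : DualSteenrod) : Prop :=
  ∃ h : x ∈ bigrading d, decomposeHom x = DirectSum.of (fun d => bigrading d) d ⟨x, h⟩

lemma IsSplitAt.mul {d e : ℤ × ℤ} {x y : DualSteenrod} (hx : IsSplitAt d x)
    (hy : IsSplitAt e y) : IsSplitAt (d + e) (x * y) := by
  obtain ⟨hx, ex⟩ := hx
  obtain ⟨hy, ey⟩ := hy
  refine ⟨SetLike.mul_mem_graded hx hy, ?_⟩
  rw [map_mul, ex, ey, DirectSum.of_mul_of]
  rfl

lemma isSplitAt_zero (d : ℤ × ℤ) : IsSplitAt d 0 :=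
  ⟨zero_mem _, (map_zero decomposeHom).trans
    (map_zero (DirectSum.of (fun d => bigrading d) d)).symm⟩

lemma isSplitAt_one : IsSplitAt 0 1 :=
  ⟨SetLike.GradedOne.one_mem, map_one decomposeHom⟩

lemma isSplitAt_gen (g : Gen) : IsSplitAt g.bidegree (mk (MvPolynomial.X g)) :=
  ⟨gen_mem g, decomposeHom_gen g⟩

lemma isSplitAt_tauScalar : IsSplitAt (0, -1) (algebraMap M2 DualSteenrod Polynomial.X) :=
  ⟨tauScalar_mem, decomposeHom_tauScalar⟩

lemma isSplitAt_mono (n : ℕ) (s : Gen →₀ ℕ) : IsSplitAt (monoDegree n s) (mono n s) := by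
  induction n with
  | zero =>
    induction s using Finsupp.induction_linear with
    | zero =>
      rw [mono_zero, show monoDegree 0 0 = 0 by simp [monoDegree]]
      exact isSplitAt_one
    | add s t hs ht =>
      have := hs.mul ht
      rwa [mono_mul, ← monoDegree_add, add_zero] at this
    | single g m =>
      induction m with
      | zero =>
        rw [Finsupp.single_zero, mono_zero, show monoDegree 0 0 = 0 by simp [monoDegree]]
        exact isSplitAt_one
      | succ m ih =>
        have h1 := isSplitAt_gen g
        rw [← mono_single,
          show g.bidegree = monoDegree 0 (Finsupp.single g 1) by simp [monoDegree]] at h1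
        have := ih.mul h1
        rwa [mono_mul, ← monoDegree_add, add_zero, ← Finsupp.single_add] at this
  | succ n ih =>
    have h1 := isSplitAt_tauScalar
    rw [← mono_one, show ((0, -1) : ℤ × ℤ) = monoDegree 1 0 by simp [monoDegree]] at h1
    have := ih.mul h1
    rwa [mono_mul, ← monoDegree_add, add_zero] at this

lemma isSplitAt_of_mem (d : ℤ × ℤ) (x : DualSteenrod) (hx : x ∈ bigrading d) : IsSplitAt d x := by
  induction hx using Submodule.span_induction with
  | mem x h =>
    obtain ⟨n, s, rfl, rfl⟩ := h
    exact isSplitAt_mono n s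
  | zero => exact isSplitAt_zero d
  | add x y _ _ ex ey =>
    obtain ⟨hx, ex⟩ := ex
    obtain ⟨hy, ey⟩ := ey
    refine ⟨add_mem hx hy, ?_⟩
    rw [map_add, ex, ey, ← map_add]
    rfl
  | smul c x _ ex =>
    rcases (by decide : ∀ c : ZMod 2, c = 0 ∨ c = 1) c with rfl | rfl
    · rw [zero_smul]
      exact isSplitAt_zero d
    · rwa [one_smul]

lemma decomposeHom_coe (d : ℤ × ℤ) (x : bigrading d) :
    decomposeHom (x : DualSteenrod) = DirectSum.of (fun d => bigrading d) d x :=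
  (isSplitAt_of_mem d x x.2).2

instance : GradedRing bigrading where
  decompose' := decomposeHom
  left_inv := coe_decomposeHom
  right_inv := by
    intro y
    induction y using DirectSum.induction_on with
    | zero => simp
    | of d x => rw [DirectSum.coeAddMonoidHom_of, decomposeHom_coe]
    | add x y hx hy => rw [map_add, map_add, hx, hy]

/-! ### Profile functions -/

/-- A profile function: `h` is a function on `{1, 2, …}` and `k` a function on `{0, 1, …}`,
both with values in `{0, 1, …, ∞}`. -/
structure Profile : Type where
  h : ℕ+ → ℕ∞
  k : ℕ → ℕ∞

namespace Profile

/-- The ideal `I(h,k)` generated by the `ξ_i ^ (2 ^ h(i))` with `h(i) < ∞` and the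
`τ_j ^ (2 ^ k(j))` with `k(j) < ∞`. -/
def ideal (P : Profile) : Ideal DualSteenrod :=
  Ideal.span ({x | ∃ (i : ℕ+) (n : ℕ), P.h i = n ∧ x = xi i ^ 2 ^ n} ∪
    {x | ∃ j n : ℕ, P.k j = n ∧ x = tau j ^ 2 ^ n})

/-- For all `i, j ≥ 1`: `h(i) ≤ j + h(i+j)` or `h(j) ≤ h(i+j)`. -/
def CondXi (P : Profile) : Prop :=
  ∀ i j : ℕ+, P.h i ≤ ((j : ℕ) : ℕ∞) + P.h (i + j) ∨ P.h j ≤ P.h (i + j)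

/-- For all `i ≥ 1`, `j ≥ 0`: `h(i) ≤ j + k(i+j)` or `k(j) ≤ k(i+j)`. -/
def CondTau (P : Profile) : Prop :=
  ∀ (i : ℕ+) (j : ℕ), P.h i ≤ (j : ℕ∞) + P.k (i + j) ∨ P.k j ≤ P.k (i + j)

/-- For all `i ≥ 0`: `h(i+1) ≤ k(i) - 1` if `k(i) ≠ 0`, and `h(i+1) = 0` if `k(i) = 0`
(with `∞ - 1 = ∞`). -/
def IsFree (P : Profile) : Prop :=
  ∀ i : ℕ, P.h i.succPNat ≤ if P.k i = 0 then 0 else P.k i - 1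

end Profile

/-- `DualSteenrod ⧸ I` is a quotient Hopf algebra of the bigraded Hopf algebra `DualSteenrod`:
the ideal `I` is homogeneous for the bigrading and is a Hopf ideal. -/
def IsQuotientHopfAlgebra (I : Ideal DualSteenrod) : Prop :=
  I.IsHomogeneous bigrading ∧ I.IsHopfIdeal M2

end MotivicSteenrod

end

open scoped TensorProduct

noncomputable section

namespace MotivicSteenrod

/-! ### The additive basis of the dual Steenrod algebra -/

/-! Once τ is inverted, ξ_{i+1} = τ_i^2 / τ and the algebra is polynomial on the τ_i. `embed` is an
integral form of this: it sends each basis monomial to a power of τ times one monomial, distinct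
ones to distinct ones. A single exponent vector n thus indexes the basis, and the `coeffHom n` are
the dual functionals up to powers of τ. For a free profile, I(h,k) is spanned by the basis monomials
with n_i ≥ 2^κ(i) for some i, where κ is `Profile.exponent` (`Profile.ideal_eq_monoIdeal`); the
other monomials give a basis of the quotient. Conditions (1) and (2) place a factor of each term of
the coproduct of a generator in the ideal, and likewise for the antipode.

Conversely, freeness is used only as absence of torsion (`Saturated`). Let k(i) be the least s with
τ_i^(2^s) in I, and h(i+1) = k(i) - 1. Since τ_i^(2^(s+1)) is a power of τ times ξ_{i+1}^(2^s),
saturation gives I(h,k) ≤ I. The heart is the opposite inclusion, by induction on topological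
degree. A homogeneous element of I, multiplied by a power of τ and stripped of its non-reduced
monomials, becomes a polynomial p in the τ_i. Let 2^m be the largest power of two dividing all
exponents of p, write p = q(X^(2^m)), and let n be an exponent of p with n_b / 2^m odd. Pairing the
left factor of the coproduct with the dual of τ_b^(2^m) yields an element whose coefficients at
exponents 2^m u are those of ∂q/∂X_b, up to powers of τ (`coeff_shearHom`); the term n survives.
Unless n is τ_b^(2^m) alone, functional and result both have lower degree, against the induction
hypothesis. So p is a scalar times τ_b^(2^m), and saturation contradicts reducedness
(`eq_zero_of_tauHom_mem`).

Condition (2) comes from pairing the right factor of the coproduct of τ_{i+j}^(2^m) with the dual of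
τ_j^(2^m), which leaves ξ_i^(2^(j+m)); condition (1) then follows because h is k shifted by one. -/

/-- The injective algebra map `τ_i ↦ τ X_i`, `ξ_{i+1} ↦ τ X_i ^ 2` into a polynomial ring. -/
def embed : DualSteenrod →ₐ[M2] MvPolynomial ℕ M2 :=
  liftHom (fun i => (Polynomial.X : M2) • MvPolynomial.X i)
    (fun i => (Polynomial.X : M2) • MvPolynomial.X i ^ 2) (fun i => by
      rw [smul_pow, smul_smul, sq (Polynomial.X : M2)])

lemma embed_tau (i : ℕ) : embed (tau i) = (Polynomial.X : M2) • MvPolynomial.X i :=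
  liftHom_tau _ _ _ i

lemma embed_xi_succ (i : ℕ) : embed (xi (i + 1)) = (Polynomial.X : M2) • MvPolynomial.X i ^ 2 :=
  liftHom_xi_succ (B := MvPolynomial ℕ M2) _ _ _ i

/-- The coefficient of `X ^ n` in `embed x`, as a functional of `x`. -/
def coeffHom (n : ℕ →₀ ℕ) : DualSteenrod →ₗ[M2] M2 :=
  MvPolynomial.lcoeff M2 n ∘ₗ embed.toLinearMap

lemma coeffHom_apply (n : ℕ →₀ ℕ) (x : DualSteenrod) :
    coeffHom n x = MvPolynomial.coeff n (embed x) := rfl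

/-- The basis monomial `∏ τ_i ^ (n_i mod 2) ξ_{i+1} ^ ⌊n_i / 2⌋`. -/
def basisMono (n : ℕ →₀ ℕ) : DualSteenrod :=
  n.prod fun i a => tau i ^ (a % 2) * xi (i + 1) ^ (a / 2)

/-- The coefficient of `embed (basisMono n)`. -/
def basisCoeff (n : ℕ →₀ ℕ) : M2 :=
  n.prod fun _ a => Polynomial.X ^ (a % 2 + a / 2)

lemma basisCoeff_ne_zero (n : ℕ →₀ ℕ) : basisCoeff n ≠ 0 :=
  Finset.prod_ne_zero_iff.2 fun _ _ => pow_ne_zero _ Polynomial.X_ne_zero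

lemma embed_basisMono (n : ℕ →₀ ℕ) :
    embed (basisMono n) = MvPolynomial.monomial n (basisCoeff n) := by
  rw [MvPolynomial.monomial_eq, basisMono, basisCoeff, Finsupp.prod, Finsupp.prod, Finsupp.prod,
    map_prod, map_prod, ← Finset.prod_mul_distrib]
  refine Finset.prod_congr rfl fun i _ => ?_
  rw [map_mul, map_pow, map_pow, embed_tau, embed_xi_succ, smul_pow, smul_pow, ← pow_mul,
    smul_mul_smul_comm, ← pow_add, ← pow_add, Nat.mod_add_div, MvPolynomial.smul_eq_C_mul]

lemma coeffHom_basisMono (n m : ℕ →₀ ℕ) :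
    coeffHom m (basisMono n) = if n = m then basisCoeff n else 0 := by
  rw [coeffHom_apply, embed_basisMono, MvPolynomial.coeff_monomial]

lemma basisMono_zero : basisMono 0 = 1 := Finsupp.prod_zero_index

lemma basisMono_add_single (n : ℕ →₀ ℕ) (i a : ℕ) :
    basisMono (n + Finsupp.single i a) =
      tau i ^ ((n i + a) % 2) * xi (i + 1) ^ ((n i + a) / 2) * basisMono (n.erase i) := by
  rw [basisMono, ← Finsupp.mul_prod_erase' _ i _ (fun _ => by simp), Finsupp.erase_add,
    Finsupp.erase_single, add_zero, Finsupp.add_apply, Finsupp.single_eq_same, basisMono]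

lemma basisMono_eq_mul_erase (n : ℕ →₀ ℕ) (i : ℕ) :
    basisMono n = tau i ^ (n i % 2) * xi (i + 1) ^ (n i / 2) * basisMono (n.erase i) := by
  simpa using basisMono_add_single n i 0

lemma xi_mul_basisMono (n : ℕ →₀ ℕ) (i : ℕ) :
    xi (i + 1) * basisMono n = basisMono (n + Finsupp.single i 2) := by
  rw [basisMono_add_single, basisMono_eq_mul_erase n i, Nat.add_mod_right,
    Nat.add_div_right _ two_pos]
  ring

lemma tau_mul_basisMono (n : ℕ →₀ ℕ) (i : ℕ) :
    tau i * basisMono n = (Polynomial.X ^ (n i % 2) : M2) • basisMono (n + Finsupp.single i 1) := by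
  rw [basisMono_add_single, basisMono_eq_mul_erase n i]
  rcases Nat.mod_two_eq_zero_or_one (n i) with h | h
  · rw [h, show (n i + 1) % 2 = 1 by omega, show (n i + 1) / 2 = n i / 2 by omega]
    simp only [pow_zero, one_smul]
    ring
  · rw [h, show (n i + 1) % 2 = 0 by omega, show (n i + 1) / 2 = n i / 2 + 1 by omega, pow_one,
      pow_one, pow_zero, one_mul, ← mul_assoc, ← mul_assoc, ← sq, tau_sq]
    simp only [smul_mul_assoc]
    congr 1
    ring

/-- Each generator carries a basis monomial to a power of τ times another one, so the span is stable
under multiplication by generators. -/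
lemma span_basisMono : ⊤ ≤ Submodule.span M2 (Set.range basisMono) := by
  have hmul : ∀ y : DualSteenrod, (∀ n, y * basisMono n ∈ Submodule.span M2 (Set.range basisMono)) →
      ∀ x ∈ Submodule.span M2 (Set.range basisMono),
        y * x ∈ Submodule.span M2 (Set.range basisMono) := by
    intro y hy x hx
    induction hx using Submodule.span_induction with
    | mem x h =>
      obtain ⟨n, rfl⟩ := h
      exact hy n
    | zero => simp
    | add a b _ _ ha hb => rw [mul_add]; exact add_mem ha hb
    | smul c a _ ha => rw [mul_smul_comm]; exact Submodule.smul_mem _ c ha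
  intro x _
  obtain ⟨p, rfl⟩ := mk_surjective x
  induction p using MvPolynomial.induction_on with
  | C a =>
    have h : mk (MvPolynomial.C a) = a • basisMono 0 := by
      rw [basisMono_zero, ← Algebra.algebraMap_eq_smul_one]
      exact mk.commutes a
    rw [h]
    exact Submodule.smul_mem _ _ (Submodule.subset_span ⟨0, rfl⟩)
  | add p q hp hq => rw [map_add]; exact add_mem (hp trivial) (hq trivial)
  | mul_X p g hp =>
    rw [map_mul, mul_comm]
    refine hmul _ (fun n => ?_) _ (hp trivial)
    cases g with
    | tau i =>
      rw [show mk (MvPolynomial.X (Gen.tau i)) = tau i from rfl, tau_mul_basisMono]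
      exact Submodule.smul_mem _ _ (Submodule.subset_span ⟨_, rfl⟩)
    | xi i =>
      rw [show mk (MvPolynomial.X (Gen.xi i)) = xi (i + 1) from rfl, xi_mul_basisMono]
      exact Submodule.subset_span ⟨_, rfl⟩

lemma linearIndependent_basisMono : LinearIndependent M2 basisMono := by
  rw [linearIndependent_iff]
  intro l hl
  ext1 n
  have h := congrArg (coeffHom n) hl
  rw [Finsupp.linearCombination_apply, Finsupp.sum, map_sum, map_zero,
    Finset.sum_eq_single n] at h
  · rw [map_smul, coeffHom_basisMono, if_pos rfl, smul_eq_mul] at h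
    exact (mul_eq_zero.1 h).resolve_right (basisCoeff_ne_zero n)
  · intro m _ hm
    rw [map_smul, coeffHom_basisMono, if_neg hm, smul_zero]
  · intro hn
    rw [Finsupp.notMem_support_iff.1 hn, zero_smul, map_zero]

/-- The basis of monomials of the dual Steenrod algebra. -/
def monoBasis : Module.Basis (ℕ →₀ ℕ) M2 DualSteenrod :=
  Module.Basis.mk linearIndependent_basisMono span_basisMono

lemma monoBasis_apply (n : ℕ →₀ ℕ) : monoBasis n = basisMono n := by
  rw [monoBasis, Module.Basis.mk_apply]

lemma coeffHom_eq (n : ℕ →₀ ℕ) (x : DualSteenrod) :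
    coeffHom n x = monoBasis.repr x n * basisCoeff n := by
  have h : coeffHom n = (LinearMap.mulRight M2 (basisCoeff n)) ∘ₗ (monoBasis.coord n) := by
    refine monoBasis.ext fun m => ?_
    rw [LinearMap.comp_apply, LinearMap.mulRight_apply, Module.Basis.coord_apply,
      Module.Basis.repr_self, monoBasis_apply, coeffHom_basisMono, Finsupp.single_apply]
    split_ifs with h
    · rw [h, one_mul]
    · rw [zero_mul]
  rw [h]
  rfl

/-! ### Monomial ideals -/

/-- The exponent `n` satisfies `n_i < 2 ^ κ(i)` for all `i`. -/
def Reduced (κ : ℕ → ℕ∞) (n : ℕ →₀ ℕ) : Prop :=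
  ∀ i s : ℕ, κ i = s → n i < 2 ^ s

lemma Reduced.mono {κ : ℕ → ℕ∞} {n m : ℕ →₀ ℕ} (h : Reduced κ n) (hm : m ≤ n) : Reduced κ m :=
  fun i s hs => (hm i).trans_lt (h i s hs)

lemma exists_of_not_reduced {κ : ℕ → ℕ∞} {n : ℕ →₀ ℕ} (h : ¬ Reduced κ n) :
    ∃ i s : ℕ, κ i = s ∧ 2 ^ s ≤ n i := by
  simpa [Reduced] using h

/-- The ideal of elements all of whose monomials are not reduced. -/
def monoIdeal (κ : ℕ → ℕ∞) : Ideal DualSteenrod where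
  carrier := {x | ∀ n, Reduced κ n → coeffHom n x = 0}
  zero_mem' := fun n _ => map_zero _
  add_mem' := fun ha hb n hn => by rw [map_add, ha n hn, hb n hn, add_zero]
  smul_mem' := fun c x hx n hn => by
    classical
    -- `embed` is multiplicative, and exponents below a reduced one are reduced, so every term of
    -- the convolution vanishes.
    rw [smul_eq_mul, coeffHom_apply, map_mul, MvPolynomial.coeff_mul]
    refine Finset.sum_eq_zero fun p hp => ?_
    rw [← coeffHom_apply p.2, hx p.2 (hn.mono ?_), mul_zero]
    rw [← Finset.HasAntidiagonal.mem_antidiagonal.1 hp]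
    exact le_add_self

lemma monoIdeal_eq_span (κ : ℕ → ℕ∞) : (monoIdeal κ).restrictScalars M2 =
    Submodule.span M2 (monoBasis '' {n | ¬ Reduced κ n}) := by
  refine le_antisymm (fun x hx => ?_) (Submodule.span_le.2 ?_)
  · rw [Module.Basis.mem_span_image]
    intro n hn hred
    have h := hx n hred
    rw [coeffHom_eq] at h
    exact (Finsupp.mem_support_iff.1 hn)
      ((mul_eq_zero.1 h).resolve_right (basisCoeff_ne_zero n))
  · rintro _ ⟨n, hn, rfl⟩ m hm
    rw [monoBasis_apply, coeffHom_basisMono, if_neg]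
    rintro rfl
    exact hn hm

/-- The reduced basis monomials span a complement of the ideal. -/
lemma free_quotient_monoIdeal (κ : ℕ → ℕ∞) : Module.Free M2 (DualSteenrod ⧸ monoIdeal κ) := by
  have hli := monoBasis.linearIndependent
  have hc : IsCompl (Submodule.span M2 (monoBasis '' {n | ¬ Reduced κ n}))
      (Submodule.span M2 (monoBasis '' {n | Reduced κ n})) := by
    constructor
    · refine hli.disjoint_span_image ?_
      exact Set.disjoint_left.2 fun n h h' => h h'
    · rw [codisjoint_iff, ← Submodule.span_union, ← Set.image_union, eq_top_iff,
        ← monoBasis.span_eq]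
      refine Submodule.span_mono ?_
      rintro _ ⟨n, rfl⟩
      exact ⟨n, (em (Reduced κ n)).symm, rfl⟩
  rw [← monoIdeal_eq_span] at hc
  have hf : Module.Free M2 (Submodule.span M2 (monoBasis '' {n | Reduced κ n})) := by
    have := hli.comp (Subtype.val : {n | Reduced κ n} → _) Subtype.val_injective
    have h2 := Module.Free.of_basis (Module.Basis.span this)
    rwa [Set.range_comp, Subtype.range_val] at h2
  exact Module.Free.of_equiv (Submodule.quotientEquivOfIsCompl _ _ hc).symm

/-! ### I(h,k) as a monomial ideal -/

lemma tau_pow_two_pow_succ (i s : ℕ) :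
    tau i ^ 2 ^ (s + 1) = (Polynomial.X ^ 2 ^ s : M2) • xi (i + 1) ^ 2 ^ s := by
  rw [pow_succ', pow_mul, tau_sq, smul_pow]

/-- The exponents of the monomial ideal attached to a profile function. -/
def Profile.exponent (P : Profile) (i : ℕ) : ℕ∞ :=
  if P.k i = 0 then 0 else P.h i.succPNat + 1

lemma Profile.IsFree.h_eq_zero {P : Profile} (hP : P.IsFree) {i : ℕ} (hi : P.k i = 0) :
    P.h i.succPNat = 0 := by
  have := hP i
  rwa [if_pos hi, nonpos_iff_eq_zero] at this

lemma Profile.xi_pow_mem_ideal {P : Profile} {i s : ℕ} (h : P.h i.succPNat = s) :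
    xi (i + 1) ^ 2 ^ s ∈ P.ideal :=
  Ideal.subset_span (Or.inl ⟨i.succPNat, s, h, rfl⟩)

lemma Profile.tau_pow_mem_ideal {P : Profile} {j s : ℕ} (h : P.k j = s) :
    tau j ^ 2 ^ s ∈ P.ideal :=
  Ideal.subset_span (Or.inr ⟨j, s, h, rfl⟩)

/-- If n_i ≥ 2^κ(i), the part of the monomial at i is already a multiple of a generator: of
ξ_{i+1}^(2^h(i+1)) when k(i) ≠ 0, of τ_i or ξ_{i+1} when k(i) = 0. -/
lemma Profile.monoIdeal_le_ideal {P : Profile} (hP : P.IsFree) :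
    monoIdeal P.exponent ≤ P.ideal := by
  change (monoIdeal P.exponent).restrictScalars M2 ≤ P.ideal.restrictScalars M2
  rw [monoIdeal_eq_span, Submodule.span_le]
  rintro _ ⟨n, hn, rfl⟩
  obtain ⟨i, s, hs, hni⟩ := exists_of_not_reduced hn
  rw [monoBasis_apply, basisMono_eq_mul_erase n i]
  refine Ideal.mul_mem_right _ _ ?_
  rw [Profile.exponent] at hs
  have key : ∀ t : ℕ, P.h i.succPNat = t → 2 ^ t ≤ n i / 2 →
      tau i ^ (n i % 2) * xi (i + 1) ^ (n i / 2) ∈ P.ideal := by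
    intro t ht hle
    rw [← Nat.sub_add_cancel hle, pow_add, ← mul_assoc]
    exact Ideal.mul_mem_left _ _ (P.xi_pow_mem_ideal ht)
  split_ifs at hs with hk
  · obtain rfl : s = 0 := by exact_mod_cast hs.symm
    rcases Nat.eq_zero_or_pos (n i / 2) with h0 | h0
    · have h1 : n i % 2 = 1 := by omega
      rw [h0, h1]
      refine Ideal.mul_mem_right _ _ ?_
      have := P.tau_pow_mem_ideal (j := i) (s := 0) (by exact_mod_cast hk)
      simpa using this
    · exact key 0 (by exact_mod_cast hP.h_eq_zero hk) (by rw [pow_zero]; exact h0)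
  · cases s with
    | zero => simp at hs
    | succ t =>
      refine key t ?_ ?_
      · push_cast at hs
        exact (ENat.add_left_injective_of_ne_top ENat.one_ne_top) hs
      · rw [pow_succ] at hni
        omega

/-- `embed` sends a generator to a multiple of a pure power of one variable; freeness of the profile
makes its exponent at least 2^κ. -/
lemma Profile.ideal_le_monoIdeal {P : Profile} (hP : P.IsFree) :
    P.ideal ≤ monoIdeal P.exponent := by
  classical
  refine Ideal.span_le.2 ?_
  rintro x (⟨i, s, hs, rfl⟩ | ⟨j, s, hs, rfl⟩) n hn
  · obtain ⟨i, rfl⟩ : ∃ j : ℕ, i = j.succPNat := ⟨i.natPred, (PNat.succPNat_natPred i).symm⟩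
    have hlt : n i < 2 ^ (s + 1) := by
      by_cases hk : P.k i = 0
      · refine (hn i 0 (by rw [exponent, if_pos hk]; rfl)).trans_le ?_
        exact Nat.pow_le_pow_right two_pos (Nat.zero_le _)
      · exact hn i (s + 1) (by rw [exponent, if_neg hk, hs]; rfl)
    rw [Nat.succPNat_coe, coeffHom_apply, map_pow, embed_xi_succ, smul_pow, ← pow_mul, ← pow_succ',
      MvPolynomial.coeff_smul, MvPolynomial.coeff_X_pow, if_neg, smul_zero]
    rintro rfl
    simp at hlt
  · have hlt : n j < 2 ^ s := by
      by_cases hk : P.k j = 0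
      · refine (hn j 0 (by rw [exponent, if_pos hk]; rfl)).trans_le ?_
        exact Nat.pow_le_pow_right two_pos (Nat.zero_le _)
      · have h1 := hP j
        rw [if_neg hk, hs] at h1
        obtain ⟨t, ht⟩ := ENat.ne_top_iff_exists.1
          (ne_top_of_le_ne_top (by exact_mod_cast ENat.natCast_ne_top (s - 1)) h1)
        -- The subtraction in s - 1 is truncated; t + 1 ≤ s needs s ≠ 0.
        have hs0 : s ≠ 0 := by
          rintro rfl
          exact hk (by exact_mod_cast hs)
        rw [← ht] at h1
        have h2 : t ≤ s - 1 := by exact_mod_cast h1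
        refine (hn j (t + 1) (by rw [exponent, if_neg hk, ← ht]; rfl)).trans_le ?_
        exact Nat.pow_le_pow_right two_pos (by omega)
    rw [coeffHom_apply, map_pow, embed_tau, smul_pow, MvPolynomial.coeff_smul,
      MvPolynomial.coeff_X_pow, if_neg, smul_zero]
    rintro rfl
    simp at hlt

lemma Profile.ideal_eq_monoIdeal {P : Profile} (hP : P.IsFree) :
    P.ideal = monoIdeal P.exponent :=
  le_antisymm (P.ideal_le_monoIdeal hP) (P.monoIdeal_le_ideal hP)

/-! ### The ideal of a profile function is a Hopf ideal -/

lemma add_pow_two_pow {B : Type*} [CommRing B] [Algebra M2 B] (a b : B) (n : ℕ) :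
    (a + b) ^ 2 ^ n = a ^ 2 ^ n + b ^ 2 ^ n := by
  simpa using sum_pow_two_pow (Finset.univ : Finset Bool) (fun t => if t then a else b) n

lemma comul_xi_pow (n m : ℕ) : CoalgebraStruct.comul (R := M2) (xi n ^ 2 ^ m) =
    ∑ p ∈ Finset.HasAntidiagonal.antidiagonal n,
      (xi p.1 ^ 2 ^ (p.2 + m)) ⊗ₜ[M2] (xi p.2 ^ 2 ^ m) := by
  rw [Bialgebra.comul_pow, comul_xi, sum_pow_two_pow]
  refine Finset.sum_congr rfl fun p _ => ?_
  rw [Algebra.TensorProduct.tmul_pow, ← pow_mul, ← pow_add]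

lemma comul_tau_pow (n m : ℕ) : CoalgebraStruct.comul (R := M2) (tau n ^ 2 ^ m) =
    ∑ p ∈ Finset.HasAntidiagonal.antidiagonal n,
      (xi p.1 ^ 2 ^ (p.2 + m)) ⊗ₜ[M2] (tau p.2 ^ 2 ^ m) + (tau n ^ 2 ^ m) ⊗ₜ[M2] 1 := by
  rw [Bialgebra.comul_pow, comul_tau, add_pow_two_pow, sum_pow_two_pow,
    Algebra.TensorProduct.tmul_pow, one_pow]
  congr 1
  refine Finset.sum_congr rfl fun p _ => ?_
  rw [Algebra.TensorProduct.tmul_pow, ← pow_mul, ← pow_add]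

lemma conjXi_pow_succ (n m : ℕ) : conjXi (n + 1) ^ 2 ^ m =
    ∑ p ∈ Finset.HasAntidiagonal.antidiagonal n,
      conjXi p.1 ^ 2 ^ (p.2 + 1 + m) * xi (p.2 + 1) ^ 2 ^ m := by
  rw [conjXi_succ, sum_pow_two_pow]
  refine Finset.sum_congr rfl fun p _ => ?_
  rw [mul_pow, ← pow_mul, ← pow_add]

lemma conjHom_tau_pow (n m : ℕ) : conjHom (tau n) ^ 2 ^ m =
    ∑ p ∈ Finset.HasAntidiagonal.antidiagonal n,
      conjXi p.1 ^ 2 ^ (p.2 + m) * tau p.2 ^ 2 ^ m := by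
  rw [conjHom_tau, sum_pow_two_pow]
  refine Finset.sum_congr rfl fun p _ => ?_
  rw [mul_pow, ← pow_mul, ← pow_add]

/-- Homogeneity of `τ_i`. -/
lemma tau_mem_bigrading (i : ℕ) : tau i ∈ bigrading (Gen.tau i).bidegree := gen_mem _

lemma xi_succ_mem_bigrading (i : ℕ) : xi (i + 1) ∈ bigrading (Gen.xi i).bidegree := gen_mem _

namespace Profile

lemma isHomogeneous_ideal (P : Profile) : P.ideal.IsHomogeneous bigrading := by
  refine Ideal.homogeneous_span _ _ ?_
  rintro x (⟨i, s, hs, rfl⟩ | ⟨j, s, hs, rfl⟩)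
  · obtain ⟨i, rfl⟩ : ∃ j : ℕ, i = j.succPNat := ⟨i.natPred, (PNat.succPNat_natPred i).symm⟩
    exact ⟨_, SetLike.pow_mem_graded _ (xi_succ_mem_bigrading i)⟩
  · exact ⟨_, SetLike.pow_mem_graded _ (tau_mem_bigrading j)⟩

variable {P : Profile}

lemma xi_pow_mem_ideal_of_le {i s : ℕ} (h : P.h i.succPNat ≤ s) :
    xi (i + 1) ^ 2 ^ s ∈ P.ideal := by
  obtain ⟨t, ht⟩ := ENat.ne_top_iff_exists.1 (ne_top_of_le_ne_top (ENat.natCast_ne_top s) h)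
  rw [← ht] at h
  exact Ideal.pow_mem_of_pow_mem _ (P.xi_pow_mem_ideal ht.symm)
    (Nat.pow_le_pow_right two_pos (by exact_mod_cast h))

lemma tau_pow_mem_ideal_of_le {j s : ℕ} (h : P.k j ≤ s) : tau j ^ 2 ^ s ∈ P.ideal := by
  obtain ⟨t, ht⟩ := ENat.ne_top_iff_exists.1 (ne_top_of_le_ne_top (ENat.natCast_ne_top s) h)
  rw [← ht] at h
  exact Ideal.pow_mem_of_pow_mem _ (P.tau_pow_mem_ideal ht.symm)
    (Nat.pow_le_pow_right two_pos (by exact_mod_cast h))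

/-- This treats the term ξ_{a+1}^(2^(b+1+m)) ⊗ ξ_{b+1}^(2^m) of a coproduct. The bound on h is kept
beside the membership because the induction for conjugates consumes it. -/
lemma CondXi.pow_mem (hP : P.CondXi) {a b m : ℕ}
    (h : P.h (a + b + 1).succPNat ≤ m) :
    xi (a + 1) ^ 2 ^ (b + 1 + m) ∈ P.ideal ∧ P.h a.succPNat ≤ (b + 1 + m : ℕ) ∨
      xi (b + 1) ^ 2 ^ m ∈ P.ideal := by
  have e : a.succPNat + b.succPNat = (a + b + 1).succPNat := by
    apply PNat.eq
    simp only [PNat.add_coe, Nat.succPNat_coe]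
    omega
  rcases hP a.succPNat b.succPNat with h1 | h1
  · rw [e] at h1
    have h2 : P.h a.succPNat ≤ (b + 1 + m : ℕ) := by
      refine h1.trans ?_
      push_cast
      exact add_le_add (by simp) h
    exact Or.inl ⟨xi_pow_mem_ideal_of_le h2, h2⟩
  · rw [e] at h1
    exact Or.inr (xi_pow_mem_ideal_of_le (h1.trans h))

/-- The analogue for ξ_{a+1}^(2^(b+m)) ⊗ τ_b^(2^m). The left factor is recorded only through h,
since the bound serves both for ξ_{a+1} and for its conjugate. -/
lemma CondTau.pow_mem (hP : P.CondTau) {a b m : ℕ} (h : P.k (a + 1 + b) ≤ m) :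
    P.h a.succPNat ≤ (b + m : ℕ) ∨ tau b ^ 2 ^ m ∈ P.ideal := by
  rcases hP a.succPNat b with h1 | h1
  · rw [Nat.succPNat_coe] at h1
    refine Or.inl (h1.trans ?_)
    push_cast
    exact add_le_add le_rfl h
  · rw [Nat.succPNat_coe] at h1
    exact Or.inr (tau_pow_mem_ideal_of_le (h1.trans h))

/-- The recursion for conjugates has the same exponents as the coproduct, so condition (1) handles
each term, with induction for the conjugate factor. -/
lemma conjXi_pow_mem (hP : P.CondXi) (a : ℕ) : ∀ m : ℕ, P.h a.succPNat ≤ m →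
    conjXi (a + 1) ^ 2 ^ m ∈ P.ideal := by
  induction a using Nat.strong_induction_on with
  | _ a ih =>
    intro m hm
    rw [conjXi_pow_succ]
    refine Ideal.sum_mem _ fun p hp => ?_
    obtain ⟨c, b⟩ := p
    rw [Finset.HasAntidiagonal.mem_antidiagonal] at hp
    dsimp only at hp ⊢
    cases c with
    | zero =>
      obtain rfl : b = a := by omega
      exact Ideal.mul_mem_left _ _ (xi_pow_mem_ideal_of_le hm)
    | succ c =>
      obtain rfl : a = c + b + 1 := by omega
      rcases hP.pow_mem hm with ⟨-, h⟩ | h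
      · exact Ideal.mul_mem_right _ _ (ih c (by omega) _ h)
      · exact Ideal.mul_mem_left _ _ h

lemma antipode_mem_ideal (h1 : P.CondXi) (h2 : P.CondTau) {x : DualSteenrod} (hx : x ∈ P.ideal) :
    HopfAlgebraStruct.antipode M2 x ∈ P.ideal := by
  suffices h : P.ideal ≤ P.ideal.comap conjHom from h hx
  refine Ideal.span_le.2 ?_
  rintro x (⟨i, s, hs, rfl⟩ | ⟨j, s, hs, rfl⟩)
  · obtain ⟨i, rfl⟩ : ∃ j : ℕ, i = j.succPNat := ⟨i.natPred, (PNat.succPNat_natPred i).symm⟩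
    rw [SetLike.mem_coe, Ideal.mem_comap, map_pow, conjHom_xi]
    exact conjXi_pow_mem h1 i s hs.le
  · rw [SetLike.mem_coe, Ideal.mem_comap, map_pow, conjHom_tau_pow]
    refine Ideal.sum_mem _ fun p hp => ?_
    obtain ⟨c, b⟩ := p
    rw [Finset.HasAntidiagonal.mem_antidiagonal] at hp
    dsimp only at hp ⊢
    cases c with
    | zero =>
      obtain rfl : b = j := by omega
      exact Ideal.mul_mem_left _ _ (P.tau_pow_mem_ideal hs)
    | succ c =>
      subst hp
      rcases h2.pow_mem hs.le with h | h
      · exact Ideal.mul_mem_right _ _ (conjXi_pow_mem h1 c _ h)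
      · exact Ideal.mul_mem_left _ _ h

lemma counit_eq_zero_of_mem_ideal {x : DualSteenrod} (hx : x ∈ P.ideal) :
    CoalgebraStruct.counit (R := M2) x = 0 := by
  suffices h : P.ideal ≤ RingHom.ker counitHom from h hx
  refine Ideal.span_le.2 ?_
  rintro x (⟨i, s, hs, rfl⟩ | ⟨j, s, hs, rfl⟩)
  · rw [SetLike.mem_coe, RingHom.mem_ker, map_pow, counitHom_xi, if_neg i.ne_zero,
      zero_pow (pow_ne_zero _ two_ne_zero)]
  · rw [SetLike.mem_coe, RingHom.mem_ker, map_pow, counitHom_tau,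
      zero_pow (pow_ne_zero _ two_ne_zero)]

lemma map_comul_eq_zero (h1 : P.CondXi) (h2 : P.CondTau) {x : DualSteenrod} (hx : x ∈ P.ideal) :
    TensorProduct.map (P.ideal.restrictScalars M2).mkQ (P.ideal.restrictScalars M2).mkQ
      (CoalgebraStruct.comul (R := M2) x) = 0 := by
  let q := Ideal.Quotient.mkₐ M2 P.ideal
  have hq : ∀ y ∈ P.ideal, q y = 0 := fun y hy => Ideal.Quotient.eq_zero_iff_mem.2 hy
  -- As an algebra map, its kernel is an ideal, so checking generators suffices.
  let F : DualSteenrod →ₐ[M2] (DualSteenrod ⧸ P.ideal) ⊗[M2] (DualSteenrod ⧸ P.ideal) :=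
    (Algebra.TensorProduct.map q q).comp (Bialgebra.comulAlgHom M2 DualSteenrod)
  suffices h : P.ideal ≤ RingHom.ker F from h hx
  refine Ideal.span_le.2 ?_
  rintro x (⟨i, s, hs, rfl⟩ | ⟨j, s, hs, rfl⟩)
  · obtain ⟨i, rfl⟩ : ∃ j : ℕ, i = j.succPNat := ⟨i.natPred, (PNat.succPNat_natPred i).symm⟩
    change Algebra.TensorProduct.map q q (CoalgebraStruct.comul (R := M2) _) = 0
    rw [Nat.succPNat_coe, comul_xi_pow, map_sum]
    refine Finset.sum_eq_zero fun p hp => ?_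
    obtain ⟨c, b⟩ := p
    rw [Finset.HasAntidiagonal.mem_antidiagonal] at hp
    dsimp only at hp ⊢
    rw [Algebra.TensorProduct.map_tmul]
    rcases c with _ | c
    · obtain rfl : b = i + 1 := by omega
      rw [hq (xi _ ^ 2 ^ s) (P.xi_pow_mem_ideal hs), TensorProduct.tmul_zero]
    rcases b with _ | b
    · obtain rfl : c = i := by omega
      rw [zero_add, hq (xi _ ^ 2 ^ s) (P.xi_pow_mem_ideal hs), TensorProduct.zero_tmul]
    · obtain rfl : i = c + b + 1 := by omega
      rcases h1.pow_mem hs.le with ⟨h, -⟩ | h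
      · rw [hq _ h, TensorProduct.zero_tmul]
      · rw [hq _ h, TensorProduct.tmul_zero]
  · change Algebra.TensorProduct.map q q (CoalgebraStruct.comul (R := M2) _) = 0
    have h0 := hq _ (P.tau_pow_mem_ideal hs)
    rw [comul_tau_pow, map_add, map_sum, Algebra.TensorProduct.map_tmul, h0,
      TensorProduct.zero_tmul, add_zero]
    refine Finset.sum_eq_zero fun p hp => ?_
    obtain ⟨c, b⟩ := p
    rw [Finset.HasAntidiagonal.mem_antidiagonal] at hp
    dsimp only at hp ⊢
    rw [Algebra.TensorProduct.map_tmul]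
    rcases c with _ | c
    · obtain rfl : b = j := by omega
      rw [h0, TensorProduct.tmul_zero]
    · subst hp
      rcases h2.pow_mem hs.le with h | h
      · rw [hq _ (xi_pow_mem_ideal_of_le h), TensorProduct.zero_tmul]
      · rw [hq _ h, TensorProduct.tmul_zero]

lemma isHopfIdeal_ideal (h1 : P.CondXi) (h2 : P.CondTau) : P.ideal.IsHopfIdeal M2 where
  counit_eq_zero := fun _ hx => counit_eq_zero_of_mem_ideal hx
  map_mkQ_comul_eq_zero := fun _ hx => map_comul_eq_zero h1 h2 hx
  antipode_mem := fun _ hx => antipode_mem_ideal h1 h2 hx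

end Profile

/-! ### Slicing coproducts by functionals -/

/-- `∑ f(x') x''` lies in a Hopf ideal if `x` does and `f` vanishes on the ideal. -/
lemma slice_left_mem {I : Ideal DualSteenrod} (hI : I.IsHopfIdeal M2) {f : DualSteenrod →ₗ[M2] M2}
    (hf : ∀ x ∈ I, f x = 0) {x : DualSteenrod} (hx : x ∈ I) :
    TensorProduct.lid M2 DualSteenrod (f.rTensor DualSteenrod
      (CoalgebraStruct.comul (R := M2) x)) ∈ I := by
  let J := I.restrictScalars M2
  have h0 := hI.map_mkQ_comul_eq_zero hx
  let g : (DualSteenrod ⧸ J) →ₗ[M2] M2 := J.liftQ f hf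
  -- Since f factors through the quotient as g, slicing commutes with the projection, and there the
  -- coproduct of x is already zero.
  have key : (TensorProduct.lid M2 (DualSteenrod ⧸ J)).toLinearMap ∘ₗ g.rTensor (DualSteenrod ⧸ J) ∘ₗ
      TensorProduct.map J.mkQ J.mkQ =
      J.mkQ ∘ₗ (TensorProduct.lid M2 DualSteenrod).toLinearMap ∘ₗ f.rTensor DualSteenrod := by
    refine TensorProduct.ext' fun a b => ?_
    simp only [LinearMap.comp_apply, TensorProduct.map_tmul, LinearMap.rTensor_tmul,
      LinearEquiv.coe_coe, TensorProduct.lid_tmul, map_smul]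
    rfl
  have h := LinearMap.congr_fun key (CoalgebraStruct.comul (R := M2) x)
  simp only [LinearMap.comp_apply] at h
  rw [h0, map_zero, map_zero] at h
  exact (Submodule.Quotient.mk_eq_zero J).1 h.symm

/-- `∑ f(x'') x'` lies in a Hopf ideal if `x` does and `f` vanishes on the ideal. -/
lemma slice_right_mem {I : Ideal DualSteenrod} (hI : I.IsHopfIdeal M2)
    {f : DualSteenrod →ₗ[M2] M2} (hf : ∀ x ∈ I, f x = 0) {x : DualSteenrod} (hx : x ∈ I) :
    TensorProduct.rid M2 DualSteenrod (f.lTensor DualSteenrod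
      (CoalgebraStruct.comul (R := M2) x)) ∈ I := by
  let J := I.restrictScalars M2
  have h0 := hI.map_mkQ_comul_eq_zero hx
  let g : (DualSteenrod ⧸ J) →ₗ[M2] M2 := J.liftQ f hf
  have key : (TensorProduct.rid M2 (DualSteenrod ⧸ J)).toLinearMap ∘ₗ g.lTensor (DualSteenrod ⧸ J) ∘ₗ
      TensorProduct.map J.mkQ J.mkQ =
      J.mkQ ∘ₗ (TensorProduct.rid M2 DualSteenrod).toLinearMap ∘ₗ f.lTensor DualSteenrod := by
    refine TensorProduct.ext' fun a b => ?_
    simp only [LinearMap.comp_apply, TensorProduct.map_tmul, LinearMap.lTensor_tmul,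
      LinearEquiv.coe_coe, TensorProduct.rid_tmul, map_smul]
    rfl
  have h := LinearMap.congr_fun key (CoalgebraStruct.comul (R := M2) x)
  simp only [LinearMap.comp_apply] at h
  rw [h0, map_zero, map_zero] at h
  exact (Submodule.Quotient.mk_eq_zero J).1 h.symm

/-! ### Taylor expansion of the coproduct -/

/-- The specialization of `embed` at `X_b = t` and `X_i = 0` for `i ≠ b`. -/
def lineHom (b : ℕ) : DualSteenrod →ₐ[M2] Polynomial (MvPolynomial ℕ M2) :=
  (MvPolynomial.aeval fun i => if i = b then Polynomial.X else 0).comp embed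

lemma lineHom_tau (b i : ℕ) : lineHom b (tau i) =
    (Polynomial.X : M2) • if i = b then Polynomial.X else 0 := by
  rw [lineHom, AlgHom.comp_apply, embed_tau, map_smul, MvPolynomial.aeval_X]

lemma lineHom_xi_succ (b i : ℕ) : lineHom b (xi (i + 1)) =
    (Polynomial.X : M2) • (if i = b then Polynomial.X else 0) ^ 2 := by
  rw [lineHom, AlgHom.comp_apply, embed_xi_succ, map_smul, map_pow, MvPolynomial.aeval_X]

/-- Setting the other variables to zero leaves only pure powers of X_b. The functional, which is not
multiplicative, becomes a coefficient of an algebra map. -/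
lemma coeff_lineHom (b M : ℕ) (x : DualSteenrod) : (lineHom b x).coeff M =
    MvPolynomial.C (coeffHom (Finsupp.single b M) x) := by
  rw [lineHom, AlgHom.comp_apply, coeffHom_apply]
  generalize embed x = p
  induction p using MvPolynomial.induction_on' with
  | add p q hp hq => rw [map_add, Polynomial.coeff_add, hp, hq, MvPolynomial.coeff_add, map_add]
  | monomial u a =>
    rw [MvPolynomial.aeval_monomial, MvPolynomial.coeff_monomial]
    by_cases hu : u = Finsupp.single b (u b)
    · generalize u b = k at hu
      subst hu
      rw [Finsupp.prod_single_index (by rw [pow_zero]), if_pos rfl]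
      change (Polynomial.C (MvPolynomial.C a) * Polynomial.X ^ k).coeff M = _
      rw [Polynomial.coeff_C_mul_X_pow]
      by_cases h : M = k
      · rw [if_pos h, if_pos (by rw [h])]
      · rw [if_neg h, if_neg, map_zero]
        exact fun h' => h (Finsupp.single_injective b h').symm
    · obtain ⟨i, hi⟩ : ∃ i, u i ≠ Finsupp.single b (u b) i := by
        by_contra! h
        exact hu (Finsupp.ext h)
      have hib : i ≠ b := by
        rintro rfl
        simp at hi
      rw [Finsupp.single_eq_of_ne hib] at hi
      rw [Finsupp.prod, Finset.prod_eq_zero (Finsupp.mem_support_iff.2 hi)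
        (by rw [if_neg hib, zero_pow hi]), mul_zero, Polynomial.coeff_zero, if_neg, map_zero]
      rintro rfl
      simp [Finsupp.single_eq_of_ne hib] at hi

/-- The composite of the coproduct with `lineHom b` on the left and `embed` on the right. -/
def shearHom (b : ℕ) : DualSteenrod →ₐ[M2] Polynomial (MvPolynomial ℕ M2) :=
  (Algebra.TensorProduct.productMap (lineHom b)
    ((Algebra.ofId (MvPolynomial ℕ M2) (Polynomial (MvPolynomial ℕ M2))).restrictScalars M2 |>.comp embed)).comp
    (Bialgebra.comulAlgHom M2 DualSteenrod)

/-- Slices become t-coefficients of an algebra map, which is determined by its values on generators.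
-/
lemma embed_slice_left (b M : ℕ) (x : DualSteenrod) :
    embed (TensorProduct.lid M2 DualSteenrod ((coeffHom (Finsupp.single b M)).rTensor DualSteenrod
      (CoalgebraStruct.comul (R := M2) x))) = (shearHom b x).coeff M := by
  rw [shearHom, AlgHom.comp_apply, Bialgebra.comulAlgHom_apply]
  generalize (CoalgebraStruct.comul (R := M2) x) = z
  induction z using TensorProduct.induction_on with
  | zero => simp
  | add u v hu hv => simp only [map_add, Polynomial.coeff_add, hu, hv]
  | tmul u v =>
    rw [Algebra.TensorProduct.productMap_apply_tmul, LinearMap.rTensor_tmul, TensorProduct.lid_tmul,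
      map_smul, MvPolynomial.smul_eq_C_mul]
    change _ = (lineHom b u * Polynomial.C (embed v)).coeff M
    rw [Polynomial.coeff_mul_C, coeff_lineHom]

/-- The linear term in t comes only from τ_i ⊗ 1: every ξ_a with a > 0 goes to a multiple of t^2. -/
lemma shearHom_tau (b i : ℕ) : ∃ w, shearHom b (tau i) =
    Polynomial.C ((Polynomial.X : M2) • MvPolynomial.X i) +
      (if i = b then (Polynomial.X : M2) • Polynomial.X else 0) + Polynomial.X ^ 2 * w := by
  have hmem : (0, i) ∈ Finset.HasAntidiagonal.antidiagonal i := by simp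
  have hC : ∀ x : DualSteenrod, ((Algebra.ofId (MvPolynomial ℕ M2)
      (Polynomial (MvPolynomial ℕ M2))).restrictScalars M2 |>.comp embed) x =
      Polynomial.C (embed x) := fun _ => rfl
  have hdvd : (Polynomial.X ^ 2 : Polynomial (MvPolynomial ℕ M2)) ∣
      ∑ p ∈ (Finset.HasAntidiagonal.antidiagonal i).erase (0, i),
        lineHom b (xi p.1 ^ 2 ^ p.2) * Polynomial.C (embed (tau p.2)) := by
    refine Finset.dvd_sum fun p hp => Dvd.dvd.mul_right ?_ _
    obtain ⟨a, c⟩ := p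
    rw [Finset.mem_erase, Finset.HasAntidiagonal.mem_antidiagonal] at hp
    cases a with
    | zero => exact absurd (by rw [← hp.2, zero_add]) hp.1
    | succ a =>
      rw [map_pow, lineHom_xi_succ]
      refine dvd_pow ?_ (pow_ne_zero _ two_ne_zero)
      rw [Algebra.smul_def]
      refine Dvd.dvd.mul_left (pow_dvd_pow_of_dvd ?_ 2) _
      split_ifs
      · exact dvd_rfl
      · exact dvd_zero _
  obtain ⟨w, hw⟩ := hdvd
  refine ⟨w, ?_⟩
  rw [← hw, shearHom, AlgHom.comp_apply, Bialgebra.comulAlgHom_apply, comul_tau, map_add, map_sum]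
  simp only [Algebra.TensorProduct.productMap_apply_tmul, hC]
  rw [← Finset.add_sum_erase _ _ hmem, map_one, map_one, mul_one, xi_zero, one_pow, map_one,
    one_mul, embed_tau, lineHom_tau, smul_ite, smul_zero]
  ring

/-- First-order Taylor expansion in s. The increment s stays arbitrary because it is later a power
t^(2^m), with β a power of τ. -/
lemma exists_taylor (b : ℕ) (α : ℕ → MvPolynomial ℕ M2) (β : M2)
    (s : Polynomial (MvPolynomial ℕ M2)) (w : ℕ → Polynomial (MvPolynomial ℕ M2))
    (Q : MvPolynomial ℕ M2) : ∃ v,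
    MvPolynomial.aeval (fun i => Polynomial.C (α i) + (if i = b then β • s else 0) + s ^ 2 * w i) Q =
      Polynomial.C (MvPolynomial.aeval α Q) +
        β • (Polynomial.C (MvPolynomial.aeval α (MvPolynomial.pderiv b Q)) * s) + s ^ 2 * v := by
  induction Q using MvPolynomial.induction_on with
  | C a =>
    refine ⟨0, ?_⟩
    rw [MvPolynomial.aeval_C, MvPolynomial.aeval_C, MvPolynomial.pderiv_C, map_zero, map_zero,
      zero_mul, smul_zero, mul_zero, add_zero, add_zero]
    rfl
  | add p q hp hq =>
    obtain ⟨v, hv⟩ := hp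
    obtain ⟨v', hv'⟩ := hq
    refine ⟨v + v', ?_⟩
    simp only [map_add, hv, hv', add_mul, smul_add]
    ring
  | mul_X p i hp =>
    obtain ⟨v, hv⟩ := hp
    rw [map_mul, hv, MvPolynomial.aeval_X, MvPolynomial.pderiv_mul]
    simp only [map_add, map_mul, MvPolynomial.aeval_X, Algebra.smul_def]
    generalize algebraMap M2 (Polynomial (MvPolynomial ℕ M2)) β = β'
    generalize MvPolynomial.aeval α p = p0
    generalize MvPolynomial.aeval α (MvPolynomial.pderiv b p) = p1
    by_cases h : i = b
    · subst h
      rw [if_pos rfl, MvPolynomial.pderiv_X_self, map_one, map_one, mul_one]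
      exact ⟨v * Polynomial.C (α i) + v * β' * s + Polynomial.C p1 * β' ^ 2 + (Polynomial.C p0 +
        β' * (Polynomial.C p1 * s) + s ^ 2 * v) * w i, by ring⟩
    · rw [if_neg h, MvPolynomial.pderiv_X_of_ne h, map_zero, map_zero, mul_zero]
      exact ⟨v * Polynomial.C (α i) + (Polynomial.C p0 +
        β' * (Polynomial.C p1 * s) + s ^ 2 * v) * w i, by ring⟩

/-! ### Clearing the ξ_i by powers of τ, and coefficients of sheared polynomials -/

/-- The algebra map sending the polynomial variables to the `τ_i`. -/
def tauHom : MvPolynomial ℕ M2 →ₐ[M2] DualSteenrod := MvPolynomial.aeval tau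

lemma tauHom_X (i : ℕ) : tauHom (MvPolynomial.X i) = tau i := MvPolynomial.aeval_X _ _

lemma coeff_aeval_smul_X_pow {M : ℕ} (hM : M ≠ 0) (c : M2) (n : ℕ →₀ ℕ) (p : MvPolynomial ℕ M2) :
    MvPolynomial.coeff (M • n) (MvPolynomial.aeval
      (fun i => (c • MvPolynomial.X i : MvPolynomial ℕ M2) ^ M) p) =
      c ^ (n.sum fun _ a => M * a) * MvPolynomial.coeff n p := by
  induction p using MvPolynomial.induction_on' with
  | add p q hp hq => rw [map_add, MvPolynomial.coeff_add, hp, hq, MvPolynomial.coeff_add, mul_add]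
  | monomial u a =>
    have h : MvPolynomial.aeval (fun i => (c • MvPolynomial.X i : MvPolynomial ℕ M2) ^ M)
        (MvPolynomial.monomial u a) =
        MvPolynomial.C (c ^ (u.sum fun _ a => M * a)) *
          MvPolynomial.expand M (MvPolynomial.monomial u a) := by
      rw [MvPolynomial.aeval_monomial, MvPolynomial.expand, MvPolynomial.bind₁,
        MvPolynomial.aeval_monomial, mul_left_comm, MvPolynomial.algebraMap_eq]
      congr 1
      rw [Finsupp.prod, Finsupp.prod, Finsupp.sum, ← Finset.prod_pow_eq_pow_sum, map_prod,
        ← Finset.prod_mul_distrib]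
      refine Finset.prod_congr rfl fun i _ => ?_
      rw [MvPolynomial.smul_eq_C_mul, mul_pow, mul_pow, ← pow_mul, map_pow]
    rw [h, MvPolynomial.coeff_C_mul, MvPolynomial.coeff_expand_smul _ hM,
      MvPolynomial.coeff_monomial]
    split_ifs with hun
    · rw [hun]
    · rw [mul_zero, mul_zero]

lemma coeffHom_tauHom (n : ℕ →₀ ℕ) (p : MvPolynomial ℕ M2) :
    coeffHom n (tauHom p) = Polynomial.X ^ (n.sum fun _ a => a) * MvPolynomial.coeff n p := by
  have h : embed.comp tauHom = MvPolynomial.aeval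
      (fun i => ((Polynomial.X : M2) • MvPolynomial.X i : MvPolynomial ℕ M2) ^ 1) := by
    refine MvPolynomial.algHom_ext fun i => ?_
    rw [AlgHom.comp_apply, tauHom_X, embed_tau, MvPolynomial.aeval_X, pow_one]
  have h2 := coeff_aeval_smul_X_pow one_ne_zero Polynomial.X n p
  rw [← h, one_smul] at h2
  simp only [one_mul] at h2
  exact h2

/-- Each factor ξ_{i+1} is traded for τ_i^2 at the cost of one τ. -/
lemma exists_smul_eq_tauHom (x : DualSteenrod) : ∃ (r : ℕ) (p : MvPolynomial ℕ M2),
    (Polynomial.X ^ r : M2) • x = tauHom p := by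
  obtain ⟨q, rfl⟩ := mk_surjective x
  induction q using MvPolynomial.induction_on with
  | C a =>
    refine ⟨0, MvPolynomial.C a, ?_⟩
    rw [pow_zero, one_smul, tauHom, MvPolynomial.aeval_C]
    exact mk.commutes a
  | add p q hp hq =>
    obtain ⟨r, p', hp⟩ := hp
    obtain ⟨s, q', hq⟩ := hq
    refine ⟨r + s, (Polynomial.X ^ s : M2) • p' + (Polynomial.X ^ r : M2) • q', ?_⟩
    rw [map_add, map_add, map_smul, map_smul, ← hp, ← hq, smul_smul, smul_smul, smul_add, ← pow_add,
      ← pow_add, add_comm s r]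
  | mul_X p g hp =>
    obtain ⟨r, p', hp⟩ := hp
    cases g with
    | tau i =>
      refine ⟨r, p' * MvPolynomial.X i, ?_⟩
      rw [map_mul, map_mul, tauHom_X, ← hp, smul_mul_assoc]
      rfl
    | xi i =>
      refine ⟨r + 1, p' * MvPolynomial.X i ^ 2, ?_⟩
      rw [map_mul, map_mul, map_pow, tauHom_X, ← hp, tau_sq, smul_mul_smul_comm, pow_succ]
      rfl

/-- Raising to the power 2^m is additive, so the Taylor expansion applies with s = t^(2^m). The
remainder starts at t^(2·2^m), so the coefficient of t^(2^m) is exactly the derivative term. -/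
lemma coeff_shearHom (b m : ℕ) (Q : MvPolynomial ℕ M2) (n : ℕ →₀ ℕ) :
    ∃ r : ℕ, MvPolynomial.coeff (2 ^ m • n)
      ((shearHom b (tauHom (MvPolynomial.expand (2 ^ m) Q))).coeff (2 ^ m)) =
        Polynomial.X ^ r * MvPolynomial.coeff n (MvPolynomial.pderiv b Q) := by
  choose w hw using shearHom_tau b
  have hM : 2 ^ m ≠ 0 := pow_ne_zero _ two_ne_zero
  have h1 : (shearHom b).comp (tauHom.comp (MvPolynomial.expand (2 ^ m))) =
      MvPolynomial.aeval (fun i => Polynomial.C (((Polynomial.X : M2) • MvPolynomial.X i) ^ 2 ^ m) +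
        (if i = b then (Polynomial.X ^ 2 ^ m : M2) • Polynomial.X ^ 2 ^ m else 0) +
        (Polynomial.X ^ 2 ^ m) ^ 2 * w i ^ 2 ^ m) := by
    refine MvPolynomial.algHom_ext fun i => ?_
    rw [AlgHom.comp_apply, AlgHom.comp_apply, MvPolynomial.expand_X, map_pow, map_pow, tauHom_X, hw,
      add_pow_two_pow (B := Polynomial (MvPolynomial ℕ M2)),
      add_pow_two_pow (B := Polynomial (MvPolynomial ℕ M2)), MvPolynomial.aeval_X, mul_pow, ← pow_mul, ← pow_mul,
      mul_comm 2, map_pow]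
    congr 2
    split_ifs
    · rw [smul_pow]
    · rw [zero_pow hM]
  obtain ⟨v, hv⟩ := exists_taylor b (fun i => ((Polynomial.X : M2) • MvPolynomial.X i) ^ 2 ^ m)
    (Polynomial.X ^ 2 ^ m) (Polynomial.X ^ 2 ^ m) (fun i => w i ^ 2 ^ m) Q
  have h2 : shearHom b (tauHom (MvPolynomial.expand (2 ^ m) Q)) = _ :=
    (DFunLike.congr_fun h1 Q).trans hv
  rw [h2, Polynomial.coeff_add, Polynomial.coeff_add, Polynomial.coeff_C, if_neg hM, zero_add,
    Polynomial.coeff_smul, Polynomial.coeff_C_mul, Polynomial.coeff_X_pow_self, mul_one, ← pow_mul,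
    Polynomial.coeff_X_pow_mul', if_neg (by omega), add_zero, MvPolynomial.coeff_smul,
    coeff_aeval_smul_X_pow hM, smul_eq_mul, ← mul_assoc, ← pow_add]
  exact ⟨_, rfl⟩

/-! ### Weights -/

/-- The topological degree `2 ^ (i + 1) - 1` of `τ_i`. -/
def genWeight (i : ℕ) : ℤ := 2 ^ (i + 1) - 1

lemma genWeight_pos (i : ℕ) : 0 < genWeight i := by
  have : (1 : ℤ) < 2 ^ (i + 1) := one_lt_pow₀ one_lt_two (by omega)
  rw [genWeight]
  omega

lemma weight_nonneg (n : ℕ →₀ ℕ) : 0 ≤ Finsupp.weight genWeight n := by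
  rw [Finsupp.weight_apply]
  exact Finset.sum_nonneg fun i _ => nsmul_nonneg (genWeight_pos i).le _

lemma weight_single (i a : ℕ) : Finsupp.weight genWeight (Finsupp.single i a) = a * genWeight i := by
  rw [Finsupp.weight_single, nsmul_eq_mul]

lemma weight_pos {n : ℕ →₀ ℕ} (hn : n ≠ 0) : 0 < Finsupp.weight genWeight n := by
  obtain ⟨i, hi⟩ := Finsupp.ne_iff.1 hn
  rw [Finsupp.weight_apply]
  exact Finset.sum_pos' (fun i _ => nsmul_nonneg (genWeight_pos i).le _)
    ⟨i, Finsupp.mem_support_iff.2 hi, nsmul_pos (genWeight_pos i) hi⟩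

lemma two_pow_mul_genWeight_injective {a b : ℕ} (m : ℕ)
    (h : (2 ^ m * genWeight a : ℤ) = 2 ^ m * genWeight b) : a = b := by
  have h1 := mul_left_cancel₀ (pow_ne_zero m (two_ne_zero (α := ℤ))) h
  rw [genWeight, genWeight, sub_left_inj] at h1
  have := Nat.pow_right_injective le_rfl (by exact_mod_cast h1 : 2 ^ (a + 1) = 2 ^ (b + 1))
  omega

/-- If the weight of `n` is odd, then some entry of `n` is odd. -/
lemma exists_odd_of_odd_weight {n : ℕ →₀ ℕ} (h : ¬ (2 : ℤ) ∣ Finsupp.weight genWeight n) :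
    ∃ i, ¬ 2 ∣ n i := by
  by_contra! hc
  refine h ?_
  rw [Finsupp.weight_apply]
  refine Finset.dvd_sum fun i _ => ?_
  change (2 : ℤ) ∣ n i • genWeight i
  rw [nsmul_eq_mul]
  exact Dvd.dvd.mul_right (by exact_mod_cast hc i) _

/-- Only the topological component of the bidegree is kept: there τ has degree 0, so it can be
treated as a scalar. -/
lemma isWeightedHomogeneous_embed {d : ℤ × ℤ} {x : DualSteenrod} (hx : x ∈ bigrading d) :
    MvPolynomial.IsWeightedHomogeneous genWeight (embed x) d.1 := by
  induction hx using Submodule.span_induction with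
  | mem x h =>
    obtain ⟨n, s, rfl, rfl⟩ := h
    rw [mono, map_smul, MvPolynomial.smul_eq_C_mul]
    refine MvPolynomial.IsWeightedHomogeneous.C_mul ?_ _
    have hgen : ∀ g : Gen, MvPolynomial.IsWeightedHomogeneous genWeight
        (embed (mk (MvPolynomial.X g))) g.bidegree.1 := by
      rintro (i | i)
      · change MvPolynomial.IsWeightedHomogeneous genWeight (embed (tau i)) (genWeight i)
        rw [embed_tau, MvPolynomial.smul_eq_C_mul]
        exact (MvPolynomial.isWeightedHomogeneous_X _ _ _).C_mul _
      · have h := ((MvPolynomial.isWeightedHomogeneous_X M2 genWeight i).pow 2).C_mul Polynomial.X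
        change MvPolynomial.IsWeightedHomogeneous genWeight (embed (xi (i + 1))) (2 ^ (i + 2) - 2)
        rw [embed_xi_succ, MvPolynomial.smul_eq_C_mul]
        convert h using 1
        rw [genWeight]
        ring
    rw [MvPolynomial.monomial_eq, map_one, one_mul, Finsupp.prod, map_prod, map_prod]
    have h := MvPolynomial.IsWeightedHomogeneous.prod s.support
      (fun g => embed (mk (MvPolynomial.X g ^ s g))) (fun g => s g • g.bidegree.1) (w := genWeight)
      (fun g _ => by
        rw [map_pow, map_pow]
        exact (hgen g).pow _)
    convert h using 1
    simp [monoDegree, Finsupp.sum, Prod.fst_sum]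
  | zero => rw [map_zero]; exact MvPolynomial.isWeightedHomogeneous_zero _ _ _
  | add x y _ _ hx hy => rw [map_add]; exact hx.add hy
  | smul c x _ hx =>
    rcases (by decide : ∀ c : ZMod 2, c = 0 ∨ c = 1) c with rfl | rfl
    · rw [zero_smul, map_zero]; exact MvPolynomial.isWeightedHomogeneous_zero _ _ _
    · rwa [one_smul]

/-! ### The profile function of a Hopf ideal -/

/-- `minExponent I i` is the least `s` with `τ_i ^ (2 ^ s) ∈ I`, or `∞` if there is none. -/
def minExponent (I : Ideal DualSteenrod) (i : ℕ) : ℕ∞ :=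
  ⨅ s : {s : ℕ // tau i ^ 2 ^ s ∈ I}, (s : ℕ∞)

lemma minExponent_le {I : Ideal DualSteenrod} {i s : ℕ} :
    minExponent I i ≤ s ↔ tau i ^ 2 ^ s ∈ I := by
  constructor
  · intro h
    have hne : Nonempty {s : ℕ // tau i ^ 2 ^ s ∈ I} := by
      by_contra hne
      rw [not_nonempty_iff] at hne
      rw [minExponent, iInf_of_empty] at h
      exact ENat.natCast_ne_top s (top_le_iff.1 h)
    -- ℕ∞ is well ordered, so the infimum of a nonempty family is attained.
    obtain ⟨t, ht⟩ := ciInf_mem (fun s : {s : ℕ // tau i ^ 2 ^ s ∈ I} => ((s : ℕ) : ℕ∞))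
    change ((t : ℕ) : ℕ∞) = minExponent I i at ht
    rw [← ht] at h
    exact Ideal.pow_mem_of_pow_mem _ t.2 (Nat.pow_le_pow_right two_pos (by exact_mod_cast h))
  · exact fun h => iInf_le (fun s : {s : ℕ // tau i ^ 2 ^ s ∈ I} => ((s : ℕ) : ℕ∞)) ⟨s, h⟩

/-- The ideal `I` is saturated: the quotient by it has no torsion over `M₂`. -/
def Saturated (I : Ideal DualSteenrod) : Prop :=
  ∀ (c : M2) (x : DualSteenrod), c ≠ 0 → c • x ∈ I → x ∈ I

lemma saturated_of_free {I : Ideal DualSteenrod} (h : Module.Free M2 (DualSteenrod ⧸ I)) :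
    Saturated I := by
  intro c x hc hx
  have h1 : c • (Ideal.Quotient.mk I x) = 0 := by
    rw [← Ideal.Quotient.eq_zero_iff_mem] at hx
    exact hx
  exact Ideal.Quotient.eq_zero_iff_mem.1 ((smul_eq_zero.1 h1).resolve_left hc)

lemma reduced_single {I : Ideal DualSteenrod} {b s : ℕ} :
    Reduced (minExponent I) (Finsupp.single b (2 ^ s)) ↔ tau b ^ 2 ^ s ∉ I := by
  rw [← minExponent_le, not_le]
  constructor
  · intro h
    by_contra! hc
    obtain ⟨t, ht⟩ := ENat.ne_top_iff_exists.1 (ne_top_of_le_ne_top (ENat.natCast_ne_top s) hc)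
    have h1 := h b t ht.symm
    rw [← ht] at hc
    rw [Finsupp.single_eq_same, Nat.pow_lt_pow_iff_right one_lt_two] at h1
    have : t ≤ s := by exact_mod_cast hc
    omega
  · intro h i t ht
    by_cases hib : i = b
    · subst hib
      rw [ht] at h
      rw [Finsupp.single_eq_same]
      exact Nat.pow_lt_pow_right one_lt_two (by exact_mod_cast h)
    · rw [Finsupp.single_eq_of_ne hib]
      positivity

lemma tauHom_monomial_mem {I : Ideal DualSteenrod} {n : ℕ →₀ ℕ} (c : M2)
    (hn : ¬ Reduced (minExponent I) n) : tauHom (MvPolynomial.monomial n c) ∈ I := by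
  obtain ⟨i, s, hs, hle⟩ := exists_of_not_reduced hn
  rw [tauHom, MvPolynomial.aeval_monomial, ← Finsupp.mul_prod_erase' _ i _ (fun _ => pow_zero _)]
  exact Ideal.mul_mem_left _ _ (Ideal.mul_mem_right _ _
    (Ideal.pow_mem_of_pow_mem _ (minExponent_le.1 hs.le) hle))

/-! ### Hopf ideals with free quotient are monomial ideals -/

lemma exists_eq_smul {M : ℕ} {n : ℕ →₀ ℕ} (h : ∀ i, M ∣ n i) : ∃ u : ℕ →₀ ℕ, n = M • u := by
  refine ⟨n.mapRange (· / M) (Nat.zero_div M), Finsupp.ext fun i => ?_⟩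
  rw [Finsupp.smul_apply, Finsupp.mapRange_apply, smul_eq_mul, Nat.mul_div_cancel' (h i)]

lemma exists_eq_expand {M : ℕ} {p : MvPolynomial ℕ M2} (h : ∀ n ∈ p.support, ∀ i, M ∣ n i) :
    ∃ q, p = MvPolynomial.expand M q := by
  refine ⟨∑ n ∈ p.support, MvPolynomial.monomial (n.mapRange (· / M) (Nat.zero_div M))
    (MvPolynomial.coeff n p), ?_⟩
  rw [map_sum]
  conv_lhs => rw [p.as_sum]
  refine Finset.sum_congr rfl fun n hn => ?_
  rw [MvPolynomial.expand_monomial]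
  refine congrArg (fun u => MvPolynomial.monomial u (MvPolynomial.coeff n p)) (Finsupp.ext fun i => ?_)
  rw [Finsupp.smul_apply, Finsupp.mapRange_apply, smul_eq_mul, Nat.mul_div_cancel' (h n hn i)]

/-- The exact power of two dividing all exponents of a nonconstant polynomial. -/
lemma exists_max_two_pow_dvd {p : MvPolynomial ℕ M2} {n : ℕ →₀ ℕ} (hn : n ∈ p.support)
    (hn0 : n ≠ 0) : ∃ m, (∀ n ∈ p.support, ∀ i, 2 ^ m ∣ n i) ∧
      ∃ n ∈ p.support, ∃ i, ¬ 2 ^ (m + 1) ∣ n i := by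
  classical
  have hex : ∃ m, ∃ n ∈ p.support, ∃ i, ¬ 2 ^ m ∣ n i := by
    obtain ⟨i, hi⟩ := Finsupp.ne_iff.1 hn0
    refine ⟨n i, n, hn, i, fun hd => ?_⟩
    exact absurd (Nat.le_of_dvd (Nat.pos_of_ne_zero hi) hd) (not_le.2 (Nat.lt_two_pow_self))
  obtain ⟨m, hm⟩ : ∃ m, Nat.find hex = m + 1 := by
    refine Nat.exists_eq_succ_of_ne_zero fun h0 => ?_
    obtain ⟨n, _, i, hi⟩ := Nat.find_spec hex
    rw [h0, pow_zero] at hi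
    exact hi (one_dvd _)
  refine ⟨m, ?_, ?_⟩
  · have := Nat.find_min hex (m := m) (by omega)
    push Not at this
    exact this
  · have := Nat.find_spec hex
    rwa [hm] at this

section

variable {I : Ideal DualSteenrod}

/-- If some exponent `n` of `p` has `n_b / 2 ^ m` odd, slicing off `τ_b ^ (2 ^ m)` on the left shows
that `n` is a power of a single variable. -/
lemma eq_single_of_not_dvd (hI : I.IsHopfIdeal M2) {d : ℤ}
    (ih : ∀ n, Reduced (minExponent I) n → Finsupp.weight genWeight n < d →
      ∀ x ∈ I, coeffHom n x = 0)
    {p : MvPolynomial ℕ M2} (hp : MvPolynomial.IsWeightedHomogeneous genWeight p d)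
    (hred : ∀ n ∈ p.support, Reduced (minExponent I) n) (hmem : tauHom p ∈ I) {m : ℕ}
    (hdvd : ∀ n ∈ p.support, ∀ i, 2 ^ m ∣ n i) {n : ℕ →₀ ℕ} (hn : n ∈ p.support) {b : ℕ}
    (hb : ¬ 2 ^ (m + 1) ∣ n b) : n = Finsupp.single b (2 ^ m) := by
  by_contra hne
  obtain ⟨q, rfl⟩ := exists_eq_expand hdvd
  obtain ⟨v, rfl⟩ := exists_eq_smul (hdvd n hn)
  have hvb : ¬ 2 ∣ v b := by
    rintro ⟨c, hc⟩
    exact hb ⟨c, by rw [Finsupp.smul_apply, hc, smul_eq_mul]; ring⟩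
  obtain ⟨u, rfl⟩ : ∃ u, v = u + Finsupp.single b 1 := by
    refine ⟨v - Finsupp.single b 1, (tsub_add_cancel_of_le ?_).symm⟩
    rw [Finsupp.single_le_iff]
    exact Nat.pos_of_ne_zero fun h => hvb (h ▸ dvd_zero 2)
  have hM : 2 ^ m ≠ 0 := pow_ne_zero _ two_ne_zero
  have hs : 2 ^ m • Finsupp.single b 1 = Finsupp.single b (2 ^ m) := by
    rw [Finsupp.smul_single, smul_eq_mul, mul_one]
  have hw := hp (MvPolynomial.mem_support_iff.1 hn)
  have hr := hred _ hn
  rw [smul_add, hs] at hw hr hne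
  rw [map_add] at hw
  have hu : 2 ^ m • u ≠ 0 := fun h => hne (by rw [h, zero_add])
  have hwu := weight_pos hu
  have hws := weight_pos (Finsupp.single_ne_zero.2 hM : Finsupp.single b (2 ^ m) ≠ 0)
  -- Both 2^m u and the exponent of τ_b^(2^m) have positive weight, hence weight below d. The
  -- induction hypothesis is used twice: for the functional, then for the slice.
  have hy := slice_left_mem hI (ih _ (hr.mono le_add_self) (by omega)) hmem
  have h0 := ih _ (hr.mono le_self_add) (by omega) _ hy
  rw [coeffHom_apply, embed_slice_left] at h0
  obtain ⟨r, hcoeff⟩ := coeff_shearHom b m q u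
  rw [hcoeff, MvPolynomial.coeff_pderiv] at h0
  -- This is the factor produced by ∂/∂X_b; v_b = u_b + 1 is odd.
  have hodd : ((u b : M2) + 1) = 1 := by
    rw [Finsupp.add_apply, Finsupp.single_eq_same] at hvb
    have h2 : u b % 2 = 0 := by omega
    rw [CharTwo.natCast_eq_ite, if_pos (Nat.even_iff.2 h2), zero_add]
  rw [MvPolynomial.mem_support_iff, MvPolynomial.coeff_expand_smul _ hM] at hn
  simp only [hodd, mul_one] at h0
  exact hn ((mul_eq_zero.1 h0).resolve_left (pow_ne_zero _ Polynomial.X_ne_zero))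

/-- Slicing leaves τ_b^(2^m) for one b; comparing degrees excludes every other exponent, and
saturation removes the scalar, contradicting reducedness. -/
lemma eq_zero_of_tauHom_mem (hI : I.IsHopfIdeal M2) (hsat : Saturated I) {d : ℤ}
    (ih : ∀ n, Reduced (minExponent I) n → Finsupp.weight genWeight n < d →
      ∀ x ∈ I, coeffHom n x = 0)
    {p : MvPolynomial ℕ M2} (hp : MvPolynomial.IsWeightedHomogeneous genWeight p d)
    (hred : ∀ n ∈ p.support, Reduced (minExponent I) n) (hmem : tauHom p ∈ I) (hd : 0 < d) :
    p = 0 := by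
  by_contra hp0
  obtain ⟨n₀, hn₀⟩ := MvPolynomial.support_nonempty.2 hp0
  have hn₀0 : n₀ ≠ 0 := by
    rintro rfl
    have := hp (MvPolynomial.mem_support_iff.1 hn₀)
    rw [map_zero] at this
    omega
  obtain ⟨m, hdvd, n, hn, b, hb⟩ := exists_max_two_pow_dvd hn₀ hn₀0
  have key : ∀ n ∈ p.support, ∀ b, ¬ 2 ^ (m + 1) ∣ n b → n = Finsupp.single b (2 ^ m) :=
    fun n hn b hb => eq_single_of_not_dvd hI ih hp hred hmem hdvd hn hb
  obtain rfl := key n hn b hb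
  have hdw : (2 ^ m * genWeight b : ℤ) = d := by
    have := hp (MvPolynomial.mem_support_iff.1 hn)
    rw [weight_single] at this
    exact_mod_cast this
  have huniq : ∀ n ∈ p.support, n = Finsupp.single b (2 ^ m) := by
    intro n hn
    obtain ⟨v, rfl⟩ := exists_eq_smul (hdvd n hn)
    have hw := hp (MvPolynomial.mem_support_iff.1 hn)
    rw [map_nsmul, nsmul_eq_mul, ← hdw] at hw
    push_cast at hw
    have hw' := mul_left_cancel₀ (pow_ne_zero m (two_ne_zero (α := ℤ))) hw
    -- The weight of v is 2^(b+1) - 1, which is odd, so some entry of v is odd and `key` applies to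
    -- this exponent too.
    obtain ⟨i, hi⟩ := exists_odd_of_odd_weight (n := v) (by
      rw [hw', genWeight, pow_succ]
      omega)
    have hvi := key _ hn i (by
      rw [Finsupp.smul_apply, smul_eq_mul, pow_succ]
      exact fun h => hi (Nat.dvd_of_mul_dvd_mul_left (by positivity) h))
    have hw2 := hp (MvPolynomial.mem_support_iff.1 hn)
    rw [hvi, weight_single, ← hdw] at hw2
    push_cast at hw2
    rw [hvi, two_pow_mul_genWeight_injective m hw2]
  have hpm : p = MvPolynomial.monomial (Finsupp.single b (2 ^ m))
      (MvPolynomial.coeff (Finsupp.single b (2 ^ m)) p) := by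
    conv_lhs => rw [p.as_sum]
    exact Finset.sum_eq_single_of_mem _ hn fun n' hn' h => absurd (huniq n' hn') h
  rw [hpm, tauHom, MvPolynomial.aeval_monomial, Finsupp.prod_single_index (by rw [pow_zero]),
    ← Algebra.smul_def] at hmem
  exact reduced_single.1 (hred _ hn) (hsat _ _ (MvPolynomial.mem_support_iff.1 hn) hmem)

lemma coeffHom_zero_eq_counit (x : DualSteenrod) :
    coeffHom 0 x = CoalgebraStruct.counit (R := M2) x := by
  have h : ((MvPolynomial.aeval fun _ => 0).comp embed : DualSteenrod →ₐ[M2] M2) = counitHom := by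
    refine algHom_ext (fun i => ?_) (fun i => ?_)
    · rw [AlgHom.comp_apply, embed_tau, map_smul, MvPolynomial.aeval_X, smul_zero, counitHom_tau]
    · cases i with
      | zero => simp
      | succ i =>
        rw [AlgHom.comp_apply, embed_xi_succ, map_smul, map_pow, MvPolynomial.aeval_X,
          counitHom_xi, if_neg (Nat.succ_ne_zero i), zero_pow two_ne_zero, smul_zero]
  have h2 := DFunLike.congr_fun h x
  rw [AlgHom.comp_apply, MvPolynomial.aeval_zero'] at h2
  exact h2

/-- Homogeneity of I reduces to a homogeneous element y. Its weight equals that of n if the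
coefficient at n is nonzero, so the induction hypothesis covers everything below the degree of y. -/
lemma coeffHom_eq_zero (hhom : I.IsHomogeneous bigrading) (hI : I.IsHopfIdeal M2)
    (hsat : Saturated I) (d : ℕ) : ∀ n, Reduced (minExponent I) n →
      Finsupp.weight genWeight n < d → ∀ x ∈ I, coeffHom n x = 0 := by
  induction d with
  | zero => exact fun n _ hn => absurd hn (not_lt.2 (weight_nonneg n))
  | succ d ih =>
    intro n hn hnd x hx
    by_cases hn0 : n = 0
    · rw [hn0, coeffHom_zero_eq_counit]
      exact hI.counit_eq_zero hx
    classical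
    rw [← DirectSum.sum_support_decompose bigrading x, map_sum]
    refine Finset.sum_eq_zero fun g _ => ?_
    have hy : (DirectSum.decompose bigrading x g : DualSteenrod) ∈ I := hhom g hx
    have hyg := isWeightedHomogeneous_embed (DirectSum.decompose bigrading x g).2
    generalize (DirectSum.decompose bigrading x g : DualSteenrod) = y at hy hyg
    by_contra hne
    have hg : Finsupp.weight genWeight n = g.1 := hyg hne
    obtain ⟨r, p, hp⟩ := exists_smul_eq_tauHom y
    have hcoeff : ∀ u, Polynomial.X ^ r * coeffHom u y =
        Polynomial.X ^ (u.sum fun _ a => a) * MvPolynomial.coeff u p := fun u => by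
      rw [← coeffHom_tauHom, ← hp, map_smul, smul_eq_mul]
    have hX : ∀ k : ℕ, (Polynomial.X ^ k : M2) ≠ 0 := fun k => pow_ne_zero _ Polynomial.X_ne_zero
    have hpw : MvPolynomial.IsWeightedHomogeneous genWeight p g.1 := by
      intro u hu
      refine hyg fun h0 => ?_
      have := hcoeff u
      rw [coeffHom_apply, h0, mul_zero] at this
      exact mul_ne_zero (hX _) hu this.symm
    -- The non-reduced part lies in I term by term, so the reduced part does as well, and it has the
    -- same coefficient at n.
    let p' := ∑ u ∈ p.support with Reduced (minExponent I) u,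
      MvPolynomial.monomial u (MvPolynomial.coeff u p)
    let p'' := ∑ u ∈ p.support with ¬ Reduced (minExponent I) u,
      MvPolynomial.monomial u (MvPolynomial.coeff u p)
    have hsum : p' + p'' = p := by
      rw [Finset.sum_filter_add_sum_filter_not]
      exact p.support_sum_monomial_coeff
    have hmem'' : tauHom p'' ∈ I := by
      rw [map_sum]
      exact Ideal.sum_mem _ fun u hu => tauHom_monomial_mem _ (Finset.mem_filter.1 hu).2
    have hmem' : tauHom p' ∈ I := by
      rw [← hsum, map_add] at hp
      refine (Ideal.add_mem_iff_left I hmem'').1 ?_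
      rw [← hp, Algebra.smul_def]
      exact Ideal.mul_mem_left _ _ hy
    have hc : ∀ u, MvPolynomial.coeff u p' =
        if Reduced (minExponent I) u then MvPolynomial.coeff u p else 0 := by
      intro u
      rw [MvPolynomial.coeff_sum]
      simp only [MvPolynomial.coeff_monomial, Finset.sum_ite_eq', Finset.mem_filter,
        MvPolynomial.mem_support_iff]
      by_cases h1 : Reduced (minExponent I) u <;> by_cases h2 : MvPolynomial.coeff u p = 0 <;>
        simp [h1, h2]
    have hz : p' = 0 := by
      refine eq_zero_of_tauHom_mem hI hsat (d := g.1) (fun u hu hud => ih u hu ?_) ?_ ?_ hmem' ?_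
      · push_cast at hnd
        omega
      · intro u hu
        rw [hc] at hu
        exact hpw fun h0 => hu (by rw [h0, ite_self])
      · intro u hu
        rw [MvPolynomial.mem_support_iff, hc] at hu
        exact (ite_ne_right_iff.1 hu).1
      · rw [← hg]
        exact weight_pos hn0
    have h1 := hc n
    rw [hz, if_pos hn, MvPolynomial.coeff_zero] at h1
    have h2 := hcoeff n
    rw [← h1, mul_zero] at h2
    exact mul_ne_zero (hX _) hne h2

lemma le_monoIdeal (hhom : I.IsHomogeneous bigrading) (hI : I.IsHopfIdeal M2)
    (hsat : Saturated I) : I ≤ monoIdeal (minExponent I) := fun x hx n hn =>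
  coeffHom_eq_zero hhom hI hsat ((Finsupp.weight genWeight n).toNat + 1) n hn (by
    have := weight_nonneg n
    push_cast
    omega) x hx

/-- The profile function of a Hopf ideal. -/
def profile (I : Ideal DualSteenrod) : Profile where
  h i := minExponent I i.natPred - 1
  k := minExponent I

lemma profile_h_succPNat (I : Ideal DualSteenrod) (i : ℕ) :
    (profile I).h i.succPNat = minExponent I i - 1 := by
  change minExponent I i.succPNat.natPred - 1 = _
  rw [Nat.natPred_succPNat]

lemma profile_isFree (I : Ideal DualSteenrod) : (profile I).IsFree := by
  intro i
  rw [profile_h_succPNat]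
  change _ ≤ if minExponent I i = 0 then 0 else minExponent I i - 1
  split_ifs with h
  · rw [h, zero_tsub]
  · exact le_rfl

/-- Choosing h(i+1) = k(i) - 1, the largest value a free profile allows, makes h(i+1) + 1 equal to
k(i) where k(i) ≠ 0. -/
lemma profile_exponent (I : Ideal DualSteenrod) : (profile I).exponent = minExponent I := by
  funext i
  rw [Profile.exponent, profile_h_succPNat]
  change (if minExponent I i = 0 then 0 else _) = _
  split_ifs with h
  · exact h.symm
  · exact tsub_add_cancel_of_le (Order.one_le_iff_ne_zero.2 h)

lemma xi_pow_mem_of_tau_pow_mem (hsat : Saturated I) {i s : ℕ}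
    (h : tau i ^ 2 ^ (s + 1) ∈ I) : xi (i + 1) ^ 2 ^ s ∈ I := by
  rw [tau_pow_two_pow_succ] at h
  exact hsat _ _ (pow_ne_zero _ Polynomial.X_ne_zero) h

lemma profile_ideal_le (hsat : Saturated I) : (profile I).ideal ≤ I := by
  refine Ideal.span_le.2 ?_
  rintro x (⟨i, s, hs, rfl⟩ | ⟨j, s, hs, rfl⟩)
  · obtain ⟨i, rfl⟩ : ∃ j : ℕ, i = j.succPNat := ⟨i.natPred, (PNat.succPNat_natPred i).symm⟩
    rw [profile_h_succPNat] at hs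
    rw [Nat.succPNat_coe]
    refine xi_pow_mem_of_tau_pow_mem hsat (minExponent_le.1 ?_)
    exact_mod_cast tsub_le_iff_right.1 hs.le
  · exact minExponent_le.1 (le_of_eq hs)

lemma eq_profile_ideal (hhom : I.IsHomogeneous bigrading) (hI : I.IsHopfIdeal M2)
    (hsat : Saturated I) : I = (profile I).ideal := by
  refine le_antisymm ?_ (profile_ideal_le hsat)
  rw [Profile.ideal_eq_monoIdeal (profile_isFree I), profile_exponent]
  exact le_monoIdeal hhom hI hsat

/-! ### Necessity of conditions (1) and (2) -/

lemma profile_condTau (hhom : I.IsHomogeneous bigrading) (hI : I.IsHopfIdeal M2)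
    (hsat : Saturated I) : (profile I).CondTau := by
  intro i j
  obtain ⟨i, rfl⟩ : ∃ j : ℕ, i = j.succPNat := ⟨i.natPred, (PNat.succPNat_natPred i).symm⟩
  rw [profile_h_succPNat, Nat.succPNat_coe]
  change _ ≤ (j : ℕ∞) + minExponent I (i + 1 + j) ∨ minExponent I j ≤ minExponent I (i + 1 + j)
  rcases eq_or_ne (minExponent I (i + 1 + j)) ⊤ with htop | htop
  · exact Or.inr (htop ▸ le_top)
  obtain ⟨m, hm⟩ := ENat.ne_top_iff_exists.1 htop
  rw [← hm]
  refine or_iff_not_imp_right.2 fun hj => ?_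
  -- If τ_j^(2^m) is not in I, its exponent is reduced, so its dual functional vanishes on I and may
  -- be used for slicing.
  rw [minExponent_le, ← reduced_single] at hj
  have hf : ∀ x ∈ I, coeffHom (Finsupp.single j (2 ^ m)) x = 0 :=
    fun x hx => le_monoIdeal hhom hI hsat hx _ hj
  have hM : 2 ^ m ≠ 0 := pow_ne_zero _ two_ne_zero
  have hval : ∀ b, coeffHom (Finsupp.single j (2 ^ m)) (tau b ^ 2 ^ m) =
      if b = j then Polynomial.X ^ 2 ^ m else 0 := by
    intro b
    rw [coeffHom_apply, map_pow, embed_tau, smul_pow, MvPolynomial.coeff_smul,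
      MvPolynomial.coeff_X_pow, smul_eq_mul, mul_ite, mul_one, mul_zero]
    simp only [Finsupp.single_left_inj hM]
  have hone : coeffHom (Finsupp.single j (2 ^ m)) 1 = 0 := by
    rw [coeffHom_apply, map_one, MvPolynomial.coeff_one, if_neg]
    exact fun h => hM (Finsupp.single_eq_zero.1 h.symm)
  have hmem := slice_right_mem hI hf (minExponent_le.1 hm.ge)
  -- Only the term with right factor τ_j^(2^m) survives the functional; it leaves ξ_{i+1}^(2^(j+m))
  -- up to a power of τ.
  rw [comul_tau_pow, map_add, map_add, map_sum, map_sum, LinearMap.lTensor_tmul, hone,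
    TensorProduct.tmul_zero, map_zero, add_zero,
    Finset.sum_eq_single_of_mem (i + 1, j) (by simp)] at hmem
  · rw [LinearMap.lTensor_tmul, TensorProduct.rid_tmul, hval, if_pos rfl] at hmem
    have h1 := hsat _ _ (pow_ne_zero _ Polynomial.X_ne_zero) hmem
    -- Passing from ξ_{i+1} back to τ_i raises the exponent by one, which cancels against h(i+1) =
    -- k(i) - 1.
    have h2 : tau i ^ 2 ^ (j + m + 1) ∈ I := by
      rw [tau_pow_two_pow_succ, Algebra.smul_def]
      exact Ideal.mul_mem_left _ _ h1
    rw [tsub_le_iff_right]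
    exact_mod_cast minExponent_le.2 h2
  · rintro ⟨a, b⟩ hab hne
    rw [Finset.HasAntidiagonal.mem_antidiagonal] at hab
    dsimp only at hab
    rw [LinearMap.lTensor_tmul, TensorProduct.rid_tmul, hval, if_neg, zero_smul]
    rintro rfl
    exact hne (by rw [Prod.mk.injEq]; exact ⟨by omega, rfl⟩)

/-- Condition (1) at (i, j+1) is condition (2) at (i, j) after replacing k by h = k - 1 at the
shifted index. -/
lemma profile_condXi (h : (profile I).CondTau) : (profile I).CondXi := by
  intro i j
  obtain ⟨i, rfl⟩ : ∃ j : ℕ, i = j.succPNat := ⟨i.natPred, (PNat.succPNat_natPred i).symm⟩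
  obtain ⟨j, rfl⟩ : ∃ i : ℕ, j = i.succPNat := ⟨j.natPred, (PNat.succPNat_natPred j).symm⟩
  have e : i.succPNat + j.succPNat = (i + 1 + j).succPNat := by
    apply PNat.eq
    simp only [PNat.add_coe, Nat.succPNat_coe]
    omega
  rw [e, profile_h_succPNat, profile_h_succPNat, profile_h_succPNat, Nat.succPNat_coe]
  rcases h i.succPNat j with h | h
  · left
    rw [profile_h_succPNat, Nat.succPNat_coe] at h
    refine h.trans ?_
    change (j : ℕ∞) + minExponent I (i + 1 + j) ≤ _
    push_cast
    rw [add_assoc (j : ℕ∞)]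
    -- The extra 1 in j + 1 absorbs the subtraction: k ≤ 1 + (k - 1), also when k = 0.
    exact add_le_add le_rfl le_add_tsub
  · right
    rw [Nat.succPNat_coe] at h
    exact tsub_le_tsub_right h 1

end

end MotivicSteenrod

end

theorem theoremA (I : Ideal MotivicSteenrod.DualSteenrod) :
    (MotivicSteenrod.IsQuotientHopfAlgebra I ∧
      Module.Free MotivicSteenrod.M2 (MotivicSteenrod.DualSteenrod ⧸ I)) ↔
    ∃ P : MotivicSteenrod.Profile, P.IsFree ∧ P.CondXi ∧ P.CondTau ∧ I = P.ideal := by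
  constructor
  · rintro ⟨⟨hhom, hI⟩, hfree⟩
    have hsat := MotivicSteenrod.saturated_of_free hfree
    have hτ := MotivicSteenrod.profile_condTau hhom hI hsat
    exact ⟨MotivicSteenrod.profile I, MotivicSteenrod.profile_isFree I,
      MotivicSteenrod.profile_condXi hτ, hτ, MotivicSteenrod.eq_profile_ideal hhom hI hsat⟩
  · rintro ⟨P, hP, hξ, hτ, rfl⟩
    refine ⟨⟨P.isHomogeneous_ideal, MotivicSteenrod.Profile.isHopfIdeal_ideal hξ hτ⟩, ?_⟩
    rw [MotivicSteenrod.Profile.ideal_eq_monoIdeal hP]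
    exact MotivicSteenrod.free_quotient_monoIdeal _
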